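/- A graph is planar if it can be drawn in the Euclidean plane without crossings: vertices are distinct points, each edge is a simple curve joining its endpoints and containing no other vertex, and the curves of two distinct edges meet only at common endpoints. Let $P_k$ denote the path on $k$ vertices, and for a positive integer $n$ let $\mathbf{N}_{\mathcal P}(n,P_k)$ denote the maximum, over all simple planar graphs $G$ on $n$ vertices, of the number of (unlabeled) copies of $P_k$ in $G$, that is, of subgraphs of $G$ isomorphic to $P_k$. Then, as $n\to\infty$, $$\mathbf{N}_{\mathcal P}(n,P_7)=\frac{4}{27}\,n^4+O\bigl(n^{4-1/5}\bigr),$$ and for every integer $m\ge 4$, $$\mathbf{N}_{\mathcal P}(n,P_{2m+1})\le\frac{n^{m+1}}{2\,(m-1)!}+O\bigl(n^{m+4/5}\bigr),$$ where the constant implicit in the second $O$ may depend on $m$. -/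

import Mathlib

open Filter Asymptotics

/-- A drawing of the graph `G` in the Euclidean plane without crossings: the vertices are distinct
points, every edge is a simple curve joining its two endpoints, no curve passes through a further
vertex, and the curves of two different edges meet only in common endpoints of these edges. -/
structure PlaneDrawing {V : Type*} (G : SimpleGraph V) where
  /-- the point that represents a vertex -/
  point : V → EuclideanSpace ℝ (Fin 2)
  point_injective : Function.Injective point
  /-- the curve that represents an edge, once for each of the two directions of the edge -/
  arc : ∀ ⦃u v : V⦄, G.Adj u v → Path (point u) (point v)
  arc_injective : ∀ ⦃u v : V⦄ (h : G.Adj u v), Function.Injective (arc h)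
  /-- both directions of an edge trace the same curve -/
  range_arc_symm : ∀ ⦃u v : V⦄ (h : G.Adj u v), Set.range (arc h.symm) = Set.range (arc h)
  arc_avoids_vertices : ∀ ⦃u v : V⦄ (h : G.Adj u v) (w : V),
    point w ∈ Set.range (arc h) → w = u ∨ w = v
  arc_inter_arc : ∀ ⦃u v x y : V⦄ (h : G.Adj u v) (h' : G.Adj x y), s(u, v) ≠ s(x, y) →
    ∀ p ∈ Set.range (arc h) ∩ Set.range (arc h'), ∃ w ∈ s(u, v), w ∈ s(x, y) ∧ p = point w

/-- A graph is planar if it can be drawn in the plane without crossings. -/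
def IsPlanar {V : Type*} (G : SimpleGraph V) : Prop :=
  Nonempty (PlaneDrawing G)

/-- The maximum number of (unlabelled) copies of `H` in a planar graph on `n` vertices. A copy of
`H` in `G` is a subgraph of `G` that is isomorphic to `H`. -/
noncomputable def maxPlanarCopies {W : Type*} (n : ℕ) (H : SimpleGraph W) : ℕ :=
  sSup {k : ℕ | ∃ G : SimpleGraph (Fin n), IsPlanar G ∧ G.copyCount H = k}

theorem isPlanar_bot (n : ℕ) : IsPlanar (⊥ : SimpleGraph (Fin n)) :=
  ⟨{ point := fun i => !₂[((i : ℕ) : ℝ), 0]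
     point_injective := fun i j h => by
      have h0 := congrArg (fun p : EuclideanSpace ℝ (Fin 2) => p 0) h
      exact Fin.ext (by simpa using h0)
     arc := fun _ _ h => h.elim
     arc_injective := fun _ _ h => h.elim
     range_arc_symm := fun _ _ h => h.elim
     arc_avoids_vertices := fun _ _ h => h.elim
     arc_inter_arc := fun _ _ _ _ h => h.elim }⟩

/-- The supremum in the definition of `maxPlanarCopies` is a maximum. -/
theorem maxPlanarCopies_isGreatest {W : Type*} (n : ℕ) (H : SimpleGraph W) :
    IsGreatest {k : ℕ | ∃ G : SimpleGraph (Fin n), IsPlanar G ∧ G.copyCount H = k}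
      (maxPlanarCopies n H) := by
  have hfin : {k : ℕ | ∃ G : SimpleGraph (Fin n), IsPlanar G ∧ G.copyCount H = k}.Finite :=
    (Set.toFinite {G : SimpleGraph (Fin n) | IsPlanar G}).image
      (fun G : SimpleGraph (Fin n) => G.copyCount H)
  exact ⟨Nat.sSup_mem ⟨_, ⊥, isPlanar_bot n, rfl⟩ hfin.bddAbove,
    fun k hk => le_csSup hfin.bddAbove hk⟩

/-!
A planar graph has linearly many edges, so a path on `2 * m + 1` vertices can be chosen in
`O(n ^ (m + 1))` ways: pick one vertex at an even position `0, 2, …, 2 * m`, and cover the others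
by `m` edges. This count also shows which paths are negligible. All but `O(n ^ (m + 4 / 5))` of
them have all their vertices at odd positions among the *hubs*, the vertices of degree greater than
`n ^ (4 / 5)`, and all their vertices at even positions *sparse*, that is, adjacent to at most two
hubs (`card_pathTuples_le`). Indeed there are `O(n ^ (1 / 5))` hubs, and three hubs have at most two
common neighbours as `K₃,₃` is not planar, so only `O(n ^ (3 / 5))` vertices are not sparse.

The remaining paths are counted by a weighted graph on the hubs: `μ x y` is the proportion of
vertices that are sparse common neighbours of `x` and `y`. As a sparse vertex has at most two hubs as
neighbours, the edges have total weight at most `1`, and the sparse degrees `d x`, as proportions,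
satisfy `d x + d z ≤ 1 + μ x z`. Up to the factor `n ^ (m + 1) / 2`, the number of paths is at most
the sum of `d x₁ * μ x₁ x₂ * ⋯ * μ x_{m-1} x_m * d x_m` over all injective sequences of hubs.

* For general `m`, deleting the vertices of the sequence one at a time bounds the total weight of
  the paths with `k ≥ 2` edges from a given vertex by `1 / (2 * k !)` (`pathSum_le`). Since `∑ d x ≤ 2`
  and `d x ≤ 1`, the sum is at most `1 / (m - 1)!`.
* For `m = 3` the sum is at most `8 / 27` (`weighted_path_sum_le`). With `Q` the sum of the squares
  of the weights, elementary estimates give the bound `(1 + Q) ^ 2 * (1 - Q) / 4`, whose maximum is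
  at `Q = 1 / 3`, as for three hubs any two of which have a third of the vertices as common
  neighbours. That graph, drawn with straight edges, gives the matching lower bound
  (`le_maxPlanarCopies_path_seven`).

The topological input is that `K₃,₃` is not planar, in a strong form: there are no continuous
curves, one for each edge, such that the curves of disjoint edges are disjoint (`no_plane_K33`).
This is a parity argument about increments of continuous logarithms of `γ s - δ t` for the curves
`γ`, `δ` of disjoint edges. The strong form excludes `K₃,₃` minors directly, since disjoint
connected subgraphs are drawn as disjoint sets (`IsPlanar.not_isMinor_K33`), and then Mader's theorem
(`isMinor_top_of_dartCount`) yields the linear bound on the number of edges.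
-/

/-! ### Continuous logarithms and the nonplanarity of `K₃,₃` -/

/-- A nowhere vanishing continuous function on a real normed space has a continuous logarithm. -/
theorem exists_continuous_log {X : Type*} [NormedAddCommGroup X] [NormedSpace ℝ X]
    {f : X → ℂ} (hf : Continuous f) (h0 : ∀ x, f x ≠ 0) :
    ∃ g : X → ℂ, Continuous g ∧ ∀ x, Complex.exp (g x) = f x := by
  obtain ⟨F, ⟨-, hF⟩, -⟩ := Complex.isCoveringMapOn_exp.existsUnique_continuousMap_lifts
    ⟨f, hf⟩ (a₀ := 0) (Complex.exp_log (h0 0)) (fun x => h0 x)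
  exact ⟨F, F.continuous, fun x => congrFun hF x⟩

/-- The increment of a continuous logarithm along a path depends only on the path, and does not
change when the path is multiplied by a constant. -/
theorem log_increment_eq {L P : ℝ → ℂ} (hL : Continuous L) (hP : Continuous P) (c : ℂ)
    (h : ∀ t, Complex.exp (L t) = c * Complex.exp (P t)) : L 1 - L 0 = P 1 - P 0 := by
  have hP' : Continuous fun t => P t + (L 0 - P 0) := by fun_prop
  have hc : c = Complex.exp (L 0 - P 0) := by
    rw [Complex.exp_sub, h 0, mul_div_assoc, div_self (Complex.exp_ne_zero _), mul_one]
  have hu := Complex.isCoveringMapOn_exp.existsUnique_continuousMap_lifts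
    (A := ℝ) ⟨fun t => Complex.exp (L t), by fun_prop⟩ (a₀ := 0) (e₀ := L 0) rfl
    (fun x => Complex.exp_ne_zero _)
  have key := hu.unique (y₁ := ⟨L, hL⟩) (y₂ := ⟨_, hP'⟩) ⟨rfl, rfl⟩
    ⟨by simp, by
      funext t
      simp only [Function.comp_apply, ContinuousMap.coe_mk]
      rw [Complex.exp_add, ← hc, h t, mul_comm]⟩
  have h1 : L 1 = P 1 + (L 0 - P 0) := congrArg (fun f : C(ℝ, ℂ) => f 1) key
  rw [h1]; ring

/-- Two vertex-disjoint edges of a drawing: since `γ s - δ t` never vanishes, the increments of its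
logarithm along the four sides of the unit square add up to zero. -/
theorem log_increments_square {γ δ P₀ P₁ Q₀ Q₁ : ℝ → ℂ} (hγ : Continuous γ) (hδ : Continuous δ)
    (hne : ∀ s t, γ s ≠ δ t)
    (hP₀ : Continuous P₀) (hP₁ : Continuous P₁) (hQ₀ : Continuous Q₀) (hQ₁ : Continuous Q₁)
    (eP₀ : ∀ s, Complex.exp (P₀ s) = γ s - δ 0) (eP₁ : ∀ s, Complex.exp (P₁ s) = γ s - δ 1)
    (eQ₀ : ∀ t, Complex.exp (Q₀ t) = δ t - γ 0) (eQ₁ : ∀ t, Complex.exp (Q₁ t) = δ t - γ 1) :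
    (P₀ 1 - P₀ 0) + (Q₁ 1 - Q₁ 0) = (P₁ 1 - P₁ 0) + (Q₀ 1 - Q₀ 0) := by
  obtain ⟨L, hL, eL⟩ := exists_continuous_log (X := ℝ × ℝ) (f := fun p => γ p.1 - δ p.2)
    (by fun_prop) (fun p => sub_ne_zero.2 (hne _ _))
  have h1 := log_increment_eq (L := fun s => L (s, 0)) (by fun_prop) hP₀ 1
    (fun s => by simp [eL, eP₀])
  have h2 := log_increment_eq (L := fun s => L (s, 1)) (by fun_prop) hP₁ 1
    (fun s => by simp [eL, eP₁])
  have h3 := log_increment_eq (L := fun t => L (0, t)) (by fun_prop) hQ₀ (-1)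
    (fun s => by simp [eL, eQ₀])
  have h4 := log_increment_eq (L := fun t => L (1, t)) (by fun_prop) hQ₁ (-1)
    (fun s => by simp [eL, eQ₁])
  linear_combination -h1 + h2 + h3 - h4

/-- For pairwise distinct points there are logarithms `A i k` of the differences `a i - a k` such
that `A k i = A i k + π i` for `i < k`. -/
theorem exists_log_differences (a : Fin 3 → ℂ) (ha : ∀ i k, i ≠ k → a i ≠ a k) :
    ∃ A : Fin 3 → Fin 3 → ℂ, (∀ i k, i ≠ k → Complex.exp (A i k) = a i - a k) ∧
      ∀ i k, i < k → A k i = A i k + Real.pi * Complex.I := by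
  refine ⟨fun i k => if i < k then Complex.log (a i - a k) else
    Complex.log (a k - a i) + Real.pi * Complex.I, fun i k h => ?_, fun i k h => ?_⟩
  · rcases lt_or_gt_of_ne h with h' | h'
    · simp only [if_pos h']
      exact Complex.exp_log (sub_ne_zero.2 (ha _ _ h))
    · simp only [if_neg h'.not_gt]
      rw [Complex.exp_add, Complex.exp_log (sub_ne_zero.2 (ha _ _ h.symm)), Complex.exp_pi_mul_I]
      ring
  · simp only [if_pos h, if_neg h.not_gt]

/-- There is no continuous drawing of `K₃,₃` in the plane in which the curves of any two disjoint
edges are disjoint; the curves need be neither simple nor disjoint when the edges share an end.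

Each logarithm increment along an edge around a vertex is, up to a term depending on the end points
only, an integral multiple of `2 π i`. In the sum over all pairs of disjoint edges of
`log_increments_square` each of these integers occurs twice, whereas the contributions of the
end points add up to an odd multiple of `2 π i`. -/
theorem no_plane_K33 (a b : Fin 3 → ℂ) (γ : Fin 3 → Fin 3 → ℝ → ℂ)
    (hγ : ∀ i j, Continuous (γ i j)) (h0 : ∀ i j, γ i j 0 = a i) (h1 : ∀ i j, γ i j 1 = b j)
    (hd : ∀ i j k l, i ≠ k → j ≠ l → ∀ s t, γ i j s ≠ γ k l t) : False := by
  have other : ∀ i : Fin 3, ∃ k, k ≠ i := by decide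
  have haγ : ∀ i j k, k ≠ i → ∀ t, γ i j t ≠ a k := by
    intro i j k hk t
    obtain ⟨l, hl⟩ := other j
    rw [← h0 k l]
    exact hd i j k l hk.symm hl.symm t 0
  have hbγ : ∀ i j l, l ≠ j → ∀ t, γ i j t ≠ b l := by
    intro i j l hl t
    obtain ⟨k, hk⟩ := other i
    rw [← h1 k l]
    exact hd i j k l hk.symm hl.symm t 1
  have hab : ∀ k j, b j ≠ a k := by
    intro k j
    obtain ⟨i, hi⟩ := other k
    rw [← h1 i j]
    exact haγ i j k hi.symm 1
  obtain ⟨A, hA, hA'⟩ := exists_log_differences a (fun i k h => by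
    rw [← h0 i 0]; exact haγ i 0 k h.symm 0)
  obtain ⟨B, hB, hB'⟩ := exists_log_differences b (fun j l h => by
    rw [← h1 0 j]; exact hbγ 0 j l h.symm 1)
  obtain ⟨M, hM⟩ : ∃ M : Fin 3 → Fin 3 → ℂ, ∀ k j, Complex.exp (M k j) = b j - a k :=
    ⟨fun k j => Complex.log (b j - a k), fun k j => Complex.exp_log (sub_ne_zero.2 (hab k j))⟩
  have hP : ∀ i j k, ∃ P : ℝ → ℂ, k ≠ i →
      Continuous P ∧ ∀ t, Complex.exp (P t) = γ i j t - a k := by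
    intro i j k
    by_cases hk : k ≠ i
    · obtain ⟨P, h⟩ := exists_continuous_log (f := fun t => γ i j t - a k)
        ((hγ i j).sub continuous_const) (fun t => sub_ne_zero.2 (haγ i j k hk t))
      exact ⟨P, fun _ => h⟩
    · exact ⟨0, fun h => absurd h hk⟩
  have hQ : ∀ i j l, ∃ P : ℝ → ℂ, l ≠ j →
      Continuous P ∧ ∀ t, Complex.exp (P t) = γ i j t - b l := by
    intro i j l
    by_cases hl : l ≠ j
    · obtain ⟨P, h⟩ := exists_continuous_log (f := fun t => γ i j t - b l)
        ((hγ i j).sub continuous_const) (fun t => sub_ne_zero.2 (hbγ i j l hl t))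
      exact ⟨P, fun _ => h⟩
    · exact ⟨0, fun h => absurd h hl⟩
  choose P hP using hP
  choose Q hQ using hQ
  have hn : ∀ i j k, ∃ n : ℤ, k ≠ i →
      P i j k 1 - P i j k 0 = M k j - A i k + n * (2 * Real.pi * Complex.I) := by
    intro i j k
    by_cases hk : k ≠ i
    · obtain ⟨n₁, e₁⟩ := Complex.exp_eq_exp_iff_exists_int.1
        (((hP i j k hk).2 1).trans ((h1 i j).symm ▸ (hM k j).symm))
      obtain ⟨n₀, e₀⟩ := Complex.exp_eq_exp_iff_exists_int.1
        (((hP i j k hk).2 0).trans ((h0 i j).symm ▸ (hA i k hk.symm).symm))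
      refine ⟨n₁ - n₀, fun _ => ?_⟩
      rw [e₁, e₀]; push_cast; ring
    · exact ⟨0, fun h => absurd h hk⟩
  have hm : ∀ i j l, ∃ n : ℤ, l ≠ j → Q i j l 1 - Q i j l 0 =
      B j l - M i l - Real.pi * Complex.I + n * (2 * Real.pi * Complex.I) := by
    intro i j l
    by_cases hl : l ≠ j
    · obtain ⟨n₁, e₁⟩ := Complex.exp_eq_exp_iff_exists_int.1
        (((hQ i j l hl).2 1).trans ((h1 i j).symm ▸ (hB j l hl.symm).symm))
      have e' : Complex.exp (M i l + Real.pi * Complex.I) = a i - b l := by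
        rw [Complex.exp_add, hM, Complex.exp_pi_mul_I]; ring
      obtain ⟨n₀, e₀⟩ := Complex.exp_eq_exp_iff_exists_int.1
        (((hQ i j l hl).2 0).trans ((h0 i j).symm ▸ e'.symm))
      refine ⟨n₁ - n₀, fun _ => ?_⟩
      rw [e₁, e₀]; push_cast; ring
    · exact ⟨0, fun h => absurd h hl⟩
  choose n hn using hn
  choose m hm using hm
  have hsq : ∀ i j k l, i ≠ k → j ≠ l →
      (P i j k 1 - P i j k 0) + (Q k l j 1 - Q k l j 0)
        = (Q i j l 1 - Q i j l 0) + (P k l i 1 - P k l i 0) := by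
    intro i j k l hik hjl
    refine log_increments_square (hγ i j) (hγ k l) (hd i j k l hik hjl)
      (hP i j k hik.symm).1 (hQ i j l hjl.symm).1 (hP k l i hik).1 (hQ k l j hjl).1 ?_ ?_ ?_ ?_
    · simpa only [h0] using (hP i j k hik.symm).2
    · simpa only [h1] using (hQ i j l hjl.symm).2
    · simpa only [h0] using (hP k l i hik).2
    · simpa only [h1] using (hQ k l j hjl).2
  have hpi : (2 * Real.pi * Complex.I : ℂ) ≠ 0 := Complex.two_pi_I_ne_zero
  have hlt : ∀ i j k l, i < k → j < l → n i j k - n k l i + m k l j - m i j l = -1 := by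
    intro i j k l hik hjl
    have h := hsq i j k l hik.ne hjl.ne
    rw [hn i j k hik.ne', hn k l i hik.ne, hm i j l hjl.ne', hm k l j hjl.ne,
      hA' i k hik, hB' j l hjl] at h
    have : ((n i j k - n k l i + m k l j - m i j l : ℤ) : ℂ) * (2 * Real.pi * Complex.I)
        = ((-1 : ℤ) : ℂ) * (2 * Real.pi * Complex.I) := by
      push_cast; linear_combination h
    exact_mod_cast mul_right_cancel₀ hpi this
  have hgt : ∀ i j k l, i < k → l < j → n i j k - n k l i + m k l j - m i j l = 0 := by
    intro i j k l hik hjl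
    have h := hsq i j k l hik.ne hjl.ne'
    rw [hn i j k hik.ne', hn k l i hik.ne, hm i j l hjl.ne, hm k l j hjl.ne',
      hA' i k hik, hB' l j hjl] at h
    have : ((n i j k - n k l i + m k l j - m i j l : ℤ) : ℂ) * (2 * Real.pi * Complex.I)
        = ((0 : ℤ) : ℂ) * (2 * Real.pi * Complex.I) := by
      push_cast; linear_combination h
    exact_mod_cast mul_right_cancel₀ hpi this
  have h01 : (0 : Fin 3) < 1 := by decide
  have h02 : (0 : Fin 3) < 2 := by decide
  have h12 : (1 : Fin 3) < 2 := by decide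
  have e₁ := hlt 0 0 1 1 h01 h01
  have e₂ := hlt 0 0 1 2 h01 h02
  have e₃ := hlt 0 1 1 2 h01 h12
  have e₄ := hlt 0 0 2 1 h02 h01
  have e₅ := hlt 0 0 2 2 h02 h02
  have e₆ := hlt 0 1 2 2 h02 h12
  have e₇ := hlt 1 0 2 1 h12 h01
  have e₈ := hlt 1 0 2 2 h12 h02
  have e₉ := hlt 1 1 2 2 h12 h12
  have f₁ := hgt 0 1 1 0 h01 h01
  have f₂ := hgt 0 2 1 0 h01 h02
  have f₃ := hgt 0 2 1 1 h01 h12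
  have f₄ := hgt 0 1 2 0 h02 h01
  have f₅ := hgt 0 2 2 0 h02 h02
  have f₆ := hgt 0 2 2 1 h02 h12
  have f₇ := hgt 1 1 2 0 h12 h01
  have f₈ := hgt 1 2 2 0 h12 h02
  have f₉ := hgt 1 2 2 1 h12 h12
  omega

/-! ### Minors and planar drawings -/

/-- `H` is a minor of `G`: there are disjoint connected branch sets in `G`, one for each vertex of
`H`, such that an edge of `G` joins the branch sets of any two adjacent vertices of `H`. -/
def IsMinor {W V : Type*} (H : SimpleGraph W) (G : SimpleGraph V) : Prop :=
  ∃ B : W → Set V, (∀ w, (G.induce (B w)).Connected) ∧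
    (∀ a b, a ≠ b → Disjoint (B a) (B b)) ∧
    ∀ a b, H.Adj a b → ∃ x ∈ B a, ∃ y ∈ B b, G.Adj x y

theorem induce_singleton_connected {V : Type*} (G : SimpleGraph V) (v : V) :
    (G.induce {v}).Connected where
  preconnected a b := by rw [Subsingleton.elim a b]
  nonempty := ⟨⟨v, rfl⟩⟩

theorem isMinor_of_copy {W V : Type*} {H : SimpleGraph W} {G : SimpleGraph V}
    (f : SimpleGraph.Copy H G) : IsMinor H G := by
  refine ⟨fun w => {f w}, fun w => induce_singleton_connected G _, fun a b hab => ?_,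
    fun a b hab => ⟨f a, rfl, f b, rfl, f.toHom.map_adj hab⟩⟩
  simpa using fun h => hab (f.injective h)

theorem IsMinor.trans {U W V : Type*} {K : SimpleGraph U} {H : SimpleGraph W} {G : SimpleGraph V}
    (hKH : IsMinor K H) (hHG : IsMinor H G) : IsMinor K G := by
  obtain ⟨C, hC, hCd, hCa⟩ := hKH
  obtain ⟨B, hB, hBd, hBa⟩ := hHG
  have hsub : ∀ u, ∀ c ∈ C u, B c ⊆ ⋃ w ∈ C u, B w :=
    fun u c hc => Set.subset_biUnion_of_mem (u := fun w => B w) hc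
  refine ⟨fun u => ⋃ w ∈ C u, B w, fun u => ?_, fun a b hab => ?_, fun a b hab => ?_⟩
  · have hin : ∀ (c : W) (hc : c ∈ C u) (x y : V) (hx : x ∈ B c) (hy : y ∈ B c),
        (G.induce (⋃ w ∈ C u, B w)).Reachable ⟨x, hsub u c hc hx⟩ ⟨y, hsub u c hc hy⟩ := by
      intro c hc x y hx hy
      exact ((hB c).preconnected ⟨x, hx⟩ ⟨y, hy⟩).map
        (SimpleGraph.induceHomOfLE G (hsub u c hc)).toHom
    have hwalk : ∀ (c d : C u), (H.induce (C u)).Reachable c d →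
        ∀ (x y : V) (hx : x ∈ B c) (hy : y ∈ B d), (G.induce (⋃ w ∈ C u, B w)).Reachable
          ⟨x, hsub u c c.2 hx⟩ ⟨y, hsub u d d.2 hy⟩ := by
      rintro c d ⟨p⟩
      induction p with
      | nil => intro x y hx hy; exact hin _ (Subtype.mem _) x y hx hy
      | @cons c e d hadj p ih =>
        intro x y hx hy
        obtain ⟨s, hs, t, ht, hst⟩ := hBa c e hadj
        refine (hin c c.2 x s hx hs).trans (SimpleGraph.Reachable.trans ?_ (ih t y ht hy))
        exact SimpleGraph.Adj.reachable (by simpa using hst)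
    obtain ⟨c⟩ := (hC u).nonempty
    obtain ⟨⟨x, hx⟩⟩ := (hB c).nonempty
    refine { preconnected := ?_, nonempty := ⟨⟨x, hsub u c c.2 hx⟩⟩ }
    rintro ⟨x, hx⟩ ⟨y, hy⟩
    obtain ⟨c, hc, hx'⟩ := Set.mem_iUnion₂.1 hx
    obtain ⟨d, hd, hy'⟩ := Set.mem_iUnion₂.1 hy
    exact hwalk ⟨c, hc⟩ ⟨d, hd⟩ ((hC u).preconnected _ _) x y hx' hy'
  · simp only [Set.disjoint_iUnion_left, Set.disjoint_iUnion_right]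
    intro c hc d hd
    refine hBd _ _ ?_
    rintro rfl
    first
      | exact (Set.disjoint_left.1 (hCd a b hab)) hc hd
      | exact (Set.disjoint_left.1 (hCd a b hab)) hd hc
  · obtain ⟨x, hx, y, hy, hxy⟩ := hCa a b hab
    obtain ⟨s, hs, t, ht, hst⟩ := hBa x y hxy
    exact ⟨s, hsub a x hx hs, t, hsub b y hy ht, hst⟩

namespace PlaneDrawing

variable {V : Type*} {G : SimpleGraph V}

/-- The part of a drawing spanned by a set `S` of vertices: the points of `S` and the curves of the
edges with both ends in `S`. -/
def shadow (D : PlaneDrawing G) (S : Set V) : Set (EuclideanSpace ℝ (Fin 2)) :=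
  {p | (∃ v ∈ S, p = D.point v) ∨
    ∃ (u v : V) (h : G.Adj u v), u ∈ S ∧ v ∈ S ∧ p ∈ Set.range (D.arc h)}

theorem shadow_mono (D : PlaneDrawing G) {S T : Set V} (h : S ⊆ T) : D.shadow S ⊆ D.shadow T := by
  rintro p (⟨v, hv, rfl⟩ | ⟨u, v, huv, hu, hv, hp⟩)
  · exact Or.inl ⟨v, h hv, rfl⟩
  · exact Or.inr ⟨u, v, huv, h hu, h hv, hp⟩

theorem disjoint_shadow (D : PlaneDrawing G) {S T : Set V} (h : Disjoint S T) :
    Disjoint (D.shadow S) (D.shadow T) := by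
  have hne : ∀ v ∈ S, v ∉ T := fun v hv => Set.disjoint_left.1 h hv
  rw [Set.disjoint_left]
  rintro p (⟨v, hv, rfl⟩ | ⟨u, v, huv, hu, hv, hp⟩) (⟨w, hw, hvw⟩ | ⟨x, y, hxy, hx, hy, hq⟩)
  · exact hne v hv (D.point_injective hvw ▸ hw)
  · rcases D.arc_avoids_vertices hxy v hq with rfl | rfl
    exacts [hne _ hv hx, hne _ hv hy]
  · rcases D.arc_avoids_vertices huv w (hvw ▸ hp) with rfl | rfl
    exacts [hne _ hu hw, hne _ hv hw]
  · have hs : s(u, v) ≠ s(x, y) := by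
      intro he
      have : u ∈ s(x, y) := he ▸ Sym2.mem_mk_left u v
      rcases Sym2.mem_iff.1 this with rfl | rfl
      exacts [hne _ hu hx, hne _ hu hy]
    obtain ⟨w, hw, hw', -⟩ := D.arc_inter_arc huv hxy hs p ⟨hp, hq⟩
    have h1 : w ∈ S := by rcases Sym2.mem_iff.1 hw with rfl | rfl <;> assumption
    have h2 : w ∈ T := by rcases Sym2.mem_iff.1 hw' with rfl | rfl <;> assumption
    exact hne w h1 h2

theorem joinedIn_of_adj (D : PlaneDrawing G) {S : Set V} {u v : V} (h : G.Adj u v)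
    (hu : u ∈ S) (hv : v ∈ S) : JoinedIn (D.shadow S) (D.point u) (D.point v) :=
  ⟨D.arc h, fun t => Or.inr ⟨u, v, h, hu, hv, t, rfl⟩⟩

theorem joinedIn_of_reachable (D : PlaneDrawing G) {S : Set V} {u v : S}
    (h : (G.induce S).Reachable u v) :
    JoinedIn (D.shadow S) (D.point u) (D.point v) := by
  obtain ⟨p⟩ := h
  induction p with
  | @nil u => exact JoinedIn.refl (Or.inl ⟨u, u.2, rfl⟩)
  | @cons u v w hadj p ih => exact (D.joinedIn_of_adj hadj u.2 v.2).trans ih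

end PlaneDrawing

/-- Disjoint connected subgraphs of a plane drawing have disjoint shadows, so a `K₃,₃` minor would
give a drawing of `K₃,₃` in which disjoint edges do not meet. -/
theorem IsPlanar.not_isMinor_K33 {V : Type*} {G : SimpleGraph V} (hG : IsPlanar G) :
    ¬ IsMinor (completeBipartiteGraph (Fin 3) (Fin 3)) G := by
  obtain ⟨D⟩ := hG
  rintro ⟨B, hB, hBd, hBa⟩
  choose c hc using fun w => (hB w).nonempty.elim fun x => (⟨x.1, x.2⟩ : ∃ v, v ∈ B w)
  have hjoin : ∀ i j : Fin 3, JoinedIn (D.shadow (B (Sum.inl i) ∪ B (Sum.inr j)))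
      (D.point (c (Sum.inl i))) (D.point (c (Sum.inr j))) := by
    intro i j
    obtain ⟨x, hx, y, hy, hxy⟩ := hBa (Sum.inl i) (Sum.inr j) (by simp)
    have h1 := (D.joinedIn_of_reachable ((hB (Sum.inl i)).preconnected
      ⟨c (Sum.inl i), hc _⟩ ⟨x, hx⟩)).mono (D.shadow_mono
        (Set.subset_union_left (t := B (Sum.inr j))))
    have h2 := (D.joinedIn_of_reachable ((hB (Sum.inr j)).preconnected
      ⟨y, hy⟩ ⟨c (Sum.inr j), hc _⟩)).mono (D.shadow_mono
        (Set.subset_union_right (s := B (Sum.inl i))))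
    exact (h1.trans (D.joinedIn_of_adj hxy (Or.inl hx) (Or.inr hy))).trans h2
  choose γ hγ using hjoin
  let e : EuclideanSpace ℝ (Fin 2) ≃ₗᵢ[ℝ] ℂ := Complex.orthonormalBasisOneI.repr.symm
  refine no_plane_K33 (fun i => e (D.point (c (Sum.inl i)))) (fun j => e (D.point (c (Sum.inr j))))
    (fun i j t => e ((γ i j).extend t)) (fun i j => e.continuous.comp (γ i j).continuous_extend)
    (fun i j => by simp) (fun i j => by simp) ?_
  intro i j k l hik hjl s t hst
  have hst' := e.injective hst
  refine Set.disjoint_left.1 (D.disjoint_shadow (S := B (Sum.inl i) ∪ B (Sum.inr j))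
    (T := B (Sum.inl k) ∪ B (Sum.inr l)) ?_) (hγ i j (Set.projIcc 0 1 zero_le_one s)) ?_
  · simp only [Set.disjoint_union_left, Set.disjoint_union_right]
    exact ⟨⟨hBd _ _ (by simpa using hik), hBd _ _ (by simp)⟩,
      ⟨hBd _ _ (by simp), hBd _ _ (by simpa using hjl)⟩⟩
  · have : γ i j (Set.projIcc 0 1 zero_le_one s) = γ k l (Set.projIcc 0 1 zero_le_one t) := hst'
    rw [this]
    exact hγ k l _

/-! ### Few edges in graphs without a complete minor -/

/-- The number of ordered pairs of adjacent vertices, that is, twice the number of edges. -/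
noncomputable def dartCount {V : Type*} [Fintype V] (G : SimpleGraph V) : ℕ := by
  classical exact (Finset.univ.filter fun p : V × V => G.Adj p.1 p.2).card

/-- The graph obtained from `G` by contracting the pair `x`, `y` to the vertex `x`. -/
def contractPair {V : Type*} (G : SimpleGraph V) (x y : V) : SimpleGraph {v : V // v ≠ y} where
  Adj u v := u ≠ v ∧ (G.Adj u v ∨ (u.1 = x ∧ G.Adj y v) ∨ (v.1 = x ∧ G.Adj u y))
  symm := ⟨by
    rintro u v ⟨hne, h⟩
    refine ⟨hne.symm, ?_⟩
    rcases h with h | ⟨h, h'⟩ | ⟨h, h'⟩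
    exacts [Or.inl h.symm, Or.inr (Or.inr ⟨h, h'.symm⟩), Or.inr (Or.inl ⟨h, h'.symm⟩)]⟩
  loopless := ⟨fun u h => h.1 rfl⟩

theorem isMinor_contractPair {V : Type*} {G : SimpleGraph V} {x y : V} (h : G.Adj x y) :
    IsMinor (contractPair G x y) G := by
  classical
  refine ⟨fun v => if v.1 = x then {x, y} else {v.1}, fun w => ?_, fun a b hab => ?_,
    fun a b hab => ?_⟩
  · have congr_set : ∀ S T : Set V, S = T → (G.induce T).Connected → (G.induce S).Connected := by
      rintro S _ rfl hS
      exact hS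
    by_cases hw : w.1 = x
    · exact congr_set _ _ (if_pos hw) (SimpleGraph.induce_pair_connected_of_adj h)
    · exact congr_set _ _ (if_neg hw) (induce_singleton_connected G _)
  · have hab' : a.1 ≠ b.1 := fun h => hab (Subtype.ext h)
    have ha := a.2
    have hb := b.2
    rw [Set.disjoint_left]
    intro z
    dsimp only
    split_ifs <;> simp only [Set.mem_insert_iff, Set.mem_singleton_iff] <;> grind
  · have key : ∀ v : {v : V // v ≠ y}, v.1 ∈ (if v.1 = x then {x, y} else {v.1} : Set V) := by
      intro v
      split_ifs with hv <;> simp [hv]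
    rcases hab.2 with h | ⟨h, h'⟩ | ⟨h, h'⟩
    · exact ⟨a, key a, b, key b, h⟩
    · exact ⟨y, by simp [h], b, key b, h'⟩
    · exact ⟨a, key a, y, by simp [h], h'⟩

/-- Contracting an edge destroys this edge and one edge for each common neighbour of its ends. -/
theorem dartCount_le_contractPair {V : Type*} [Fintype V] [DecidableEq V] (G : SimpleGraph V)
    [DecidableRel G.Adj] (x y : V) (hxy : G.Adj x y) :
    dartCount G ≤ dartCount (contractPair G x y) + 2 +
      2 * (Finset.univ.filter fun w => G.Adj x w ∧ G.Adj y w).card := by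
  classical
  set C := Finset.univ.filter fun w => G.Adj x w ∧ G.Adj y w with hC
  set D := Finset.univ.filter fun p : V × V => G.Adj p.1 p.2 with hD
  set R : Finset (V × V) := {(x, y), (y, x)} ∪ (C.image (fun w => (y, w)) ∪
    C.image (fun w => (w, y))) with hR
  have hRc : R.card ≤ 2 + 2 * C.card := by
    refine (Finset.card_union_le _ _).trans (Nat.add_le_add Finset.card_le_two ?_)
    refine (Finset.card_union_le _ _).trans ?_
    have h1 := Finset.card_image_le (s := C) (f := fun w => (y, w))
    have h2 := Finset.card_image_le (s := C) (f := fun w => (w, y))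
    omega
  have hne : x ≠ y := hxy.ne
  let r : V → {v : V // v ≠ y} := fun v => if h : v = y then ⟨x, hne⟩ else ⟨v, h⟩
  have hr : ∀ v, (r v).1 = if v = y then x else v := by
    intro v; by_cases h : v = y <;> simp [r, h]
  have hmem : ∀ u v, (u, v) ∈ D \ R → G.Adj u v ∧ ¬ (u = x ∧ v = y) ∧ ¬ (u = y ∧ v = x) ∧
      (u = y → ¬ G.Adj x v) ∧ (v = y → ¬ G.Adj x u) := by
    intro u v h
    simp only [hD, hR, hC, Finset.mem_sdiff, Finset.mem_union, Finset.mem_insert,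
      Finset.mem_singleton, Finset.mem_image, Finset.mem_filter, Finset.mem_univ, true_and,
      Prod.mk.injEq, not_or, not_exists, not_and] at h
    obtain ⟨h1, ⟨h2, h3⟩, h4, h5⟩ := h
    refine ⟨h1, fun h => h2 h.1 h.2, fun h => h3 h.1 h.2, ?_, ?_⟩
    · rintro rfl hx
      exact h4 v ⟨hx, h1⟩ rfl rfl
    · rintro rfl hx
      exact h5 u ⟨hx, h1.symm⟩ rfl rfl
  have hcard : (D \ R).card ≤ dartCount (contractPair G x y) := by
    rw [dartCount]
    refine Finset.card_le_card_of_injOn (fun p => (r p.1, r p.2)) ?_ ?_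
    · rintro ⟨u, v⟩ h
      obtain ⟨h1, h2, h3, h4, h5⟩ := hmem u v h
      have hs : G.Adj v u := h1.symm
      have := h1.ne
      simp only [Finset.coe_filter, Finset.mem_univ, true_and, Set.mem_ofPred_eq, contractPair,
        ne_eq, Subtype.ext_iff, hr]
      by_cases hu : u = y <;> by_cases hv : v = y <;> simp only [hu, hv, if_true, if_false] <;>
        grind
    · rintro ⟨u, v⟩ h ⟨u', v'⟩ h' he
      obtain ⟨h1, h2, h3, h4, h5⟩ := hmem u v h
      obtain ⟨h1', h2', h3', h4', h5'⟩ := hmem u' v' h'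
      simp only [Prod.mk.injEq, Subtype.ext_iff, hr] at he
      have hs : G.Adj v u := h1.symm
      have hs' : G.Adj v' u' := h1'.symm
      have := h1.ne
      have := h1'.ne
      simp only [Prod.mk.injEq]
      grind
  have := Finset.le_card_sdiff R D
  have hDc : dartCount G = D.card := by rw [dartCount, hD]; congr
  omega

theorem dartCount_eq_sum {V : Type*} [Fintype V] (G : SimpleGraph V) [DecidableRel G.Adj] :
    dartCount G = ∑ v, (Finset.univ.filter fun w => G.Adj v w).card := by
  classical
  rw [dartCount, ← Finset.univ_product_univ, Finset.card_filter, Finset.sum_product]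
  refine Finset.sum_congr rfl fun v _ => ?_
  simp only [Finset.card_filter]
  exact Finset.sum_congr rfl fun _ _ => by congr

/-- A complete minor in the neighbourhood of a vertex extends by that vertex. -/
theorem isMinor_top_succ {V : Type*} {G : SimpleGraph V} (v : V) (r : ℕ)
    (h : IsMinor (⊤ : SimpleGraph (Fin r)) (G.induce {w | G.Adj v w})) :
    IsMinor (⊤ : SimpleGraph (Fin (r + 1))) G := by
  obtain ⟨B, hB, hBd, hBa⟩ := h
  have hN : ∀ i, ∀ z ∈ (Subtype.val '' B i : Set V), G.Adj v z := by
    rintro i _ ⟨z, -, rfl⟩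
    exact z.2
  have hne : ∀ i, ∃ z, z ∈ (Subtype.val '' B i : Set V) := by
    intro i
    obtain ⟨z⟩ := (hB i).nonempty
    exact ⟨z.1.1, z.1, z.2, rfl⟩
  refine ⟨Fin.cons {v} fun i => Subtype.val '' B i, fun w => ?_, fun a b => ?_, fun a b => ?_⟩
  · induction w using Fin.cases with
    | zero => exact induce_singleton_connected G v
    | succ i =>
      obtain ⟨z, hz⟩ := hne i
      refine { preconnected := ?_, nonempty := ⟨⟨z, hz⟩⟩ }
      rintro ⟨_, x, hx, rfl⟩ ⟨_, y, hy, rfl⟩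
      let f : ((G.induce {w | G.Adj v w}).induce (B i)) →g G.induce (Subtype.val '' B i) :=
        { toFun := fun z => ⟨z.1.1, z.1, z.2, rfl⟩
          map_rel' := fun h => h }
      exact ((hB i).preconnected ⟨x, hx⟩ ⟨y, hy⟩).map f
  · induction a using Fin.cases with
    | zero =>
      induction b using Fin.cases with
      | zero => simp
      | succ j =>
        intro _
        simp only [Fin.cons_zero, Fin.cons_succ, Set.disjoint_singleton_left]
        exact fun h => (hN j v h).ne rfl
    | succ i =>
      induction b using Fin.cases with
      | zero =>
        intro _
        simp only [Fin.cons_zero, Fin.cons_succ, Set.disjoint_singleton_right]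
        exact fun h => (hN i v h).ne rfl
      | succ j =>
        intro hij
        exact (Set.disjoint_image_iff Subtype.val_injective).2
          (hBd i j fun h => hij (congrArg Fin.succ h))
  · induction a using Fin.cases with
    | zero =>
      induction b using Fin.cases with
      | zero => simp
      | succ j =>
        intro _
        obtain ⟨z, hz⟩ := hne j
        exact ⟨v, rfl, z, hz, hN j z hz⟩
    | succ i =>
      induction b using Fin.cases with
      | zero =>
        intro _
        obtain ⟨z, hz⟩ := hne i
        exact ⟨z, hz, v, rfl, (hN i z hz).symm⟩
      | succ j =>
        intro hij
        obtain ⟨x, hx, y, hy, hxy⟩ := hBa i j (by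
          simpa using fun h : i = j => hij.ne (congrArg Fin.succ h))
        exact ⟨x, ⟨x, hx, rfl⟩, y, ⟨y, hy, rfl⟩, hxy⟩

/-- Mader's theorem: a large average degree forces a complete minor. Either some edge lies in few
triangles, and contracting it keeps the average degree, or the neighbourhood of every vertex
has large minimum degree. -/
theorem isMinor_top_of_dartCount (r : ℕ) : ∀ (n : ℕ) {V : Type} [Fintype V] (G : SimpleGraph V),
    Fintype.card V = n → 0 < n → 2 ^ r * n ≤ dartCount G →
      IsMinor (⊤ : SimpleGraph (Fin (r + 1))) G := by
  classical
  induction r with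
  | zero =>
    intro n V _ G hn hpos _
    have : Nonempty V := Fintype.card_pos_iff.1 (hn ▸ hpos)
    obtain ⟨v⟩ := ‹Nonempty V›
    refine ⟨fun _ => {v}, fun _ => induce_singleton_connected G v, fun a b hab => ?_,
      fun a b hab => ?_⟩
    · exact absurd (Subsingleton.elim (α := Fin 1) a b) hab
    · exact absurd (Subsingleton.elim (α := Fin 1) a b) hab.ne
  | succ r ihr =>
    intro n
    induction n with
    | zero => intro V _ G _ h; omega
    | succ n ihn =>
      intro V _ G hn _ hD
      by_cases hex : ∃ x y, G.Adj x y ∧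
          (Finset.univ.filter fun w => G.Adj x w ∧ G.Adj y w).card < 2 ^ r
      · obtain ⟨x, y, hxy, hc⟩ := hex
        have hcard : Fintype.card {v : V // v ≠ y} = n := by
          rw [Fintype.card_subtype_compl]; simp [hn]
        have hpos : 0 < n := hcard ▸ Fintype.card_pos_iff.2 ⟨⟨x, hxy.ne⟩⟩
        have hle := dartCount_le_contractPair G x y hxy
        refine (ihn (contractPair G x y) hcard hpos ?_).trans (isMinor_contractPair hxy)
        rw [pow_succ] at hD ⊢
        nlinarith
      · push Not at hex
        have hpos : 0 < dartCount G := lt_of_lt_of_le (by positivity) hD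
        obtain ⟨⟨v, u⟩, hvu⟩ := Finset.card_pos.1 (by rw [dartCount] at hpos; exact hpos)
        simp only [Finset.mem_filter, Finset.mem_univ, true_and] at hvu
        refine isMinor_top_succ v (r + 1) (ihr _ (G.induce {w | G.Adj v w}) rfl
          (Fintype.card_pos_iff.2 ⟨⟨u, hvu⟩⟩) ?_)
        rw [dartCount_eq_sum, mul_comm, ← smul_eq_mul]
        refine Finset.card_nsmul_le_sum _ _ _ fun w _ => (hex v w w.2).trans ?_
        refine Finset.card_le_card_of_injOn
          (fun z => if h : G.Adj v z then ⟨z, h⟩ else w) ?_ ?_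
        · intro z hz
          simp only [Finset.coe_filter, Finset.mem_univ, true_and, Set.mem_ofPred_eq] at hz ⊢
          rw [dif_pos hz.1]
          exact hz.2
        · intro z hz z' hz' h
          simp only [Finset.coe_filter, Finset.mem_univ, true_and, Set.mem_ofPred_eq] at hz hz' h
          rw [dif_pos hz.1, dif_pos hz'.1] at h
          exact congrArg Subtype.val h

theorem IsPlanar.dartCount_le {n : ℕ} {G : SimpleGraph (Fin n)} (hG : IsPlanar G) :
    dartCount G ≤ 32 * n := by
  rcases Nat.eq_zero_or_pos n with rfl | hn
  · simp [dartCount]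
  by_contra! h
  refine hG.not_isMinor_K33 (IsMinor.trans ?_
    (isMinor_top_of_dartCount 5 n G (Fintype.card_fin n) hn (by omega)))
  exact isMinor_of_copy ⟨⟨finSumFinEquiv, fun h => by
    simpa using h.ne⟩, finSumFinEquiv.injective⟩

/-- In a planar graph, three distinct vertices have at most two common neighbours. -/
theorem IsPlanar.card_common_le {n : ℕ} {G : SimpleGraph (Fin n)} (hG : IsPlanar G)
    (f : Fin 3 ↪ Fin n) (S : Finset (Fin n)) (hS : ∀ v ∈ S, ∀ i, G.Adj (f i) v) :
    S.card ≤ 2 := by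
  by_contra! h
  obtain ⟨g⟩ : Nonempty (Fin 3 ↪ S) :=
    Function.Embedding.nonempty_of_card_le (by simpa using Nat.succ_le_of_lt h)
  have hadj : ∀ i j, G.Adj (f i) (g j) := fun i j => hS _ (g j).2 i
  refine hG.not_isMinor_K33 (isMinor_of_copy ⟨⟨Sum.elim f fun j => (g j : Fin n), ?_⟩, ?_⟩)
  · rintro (i | i) (j | j) hij
    · simp at hij
    · exact hadj i j
    · exact (hadj j i).symm
    · simp at hij
  · refine Function.Injective.sumElim f.injective (Subtype.val_injective.comp g.injective) ?_
    exact fun i j => (hadj i j).ne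

/-! ### Labelled and unlabelled copies of a path -/

/-- The injective sequences of `k` vertices in which consecutive vertices are adjacent, that is,
the labelled copies of the path on `k` vertices. -/
noncomputable def pathTuples {V : Type*} [Fintype V] (G : SimpleGraph V) (k : ℕ) :
    Finset (Fin k → V) := by
  classical exact Finset.univ.filter fun x => Function.Injective x ∧
    ∀ i j : Fin k, i.val + 1 = j.val → G.Adj (x i) (x j)

theorem mem_pathTuples {V : Type*} [Fintype V] {G : SimpleGraph V} {k : ℕ} {x : Fin k → V} :
    x ∈ pathTuples G k ↔ Function.Injective x ∧
      ∀ i j : Fin k, i.val + 1 = j.val → G.Adj (x i) (x j) := by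
  simp [pathTuples]

/-- The labelled copy of the path given by a sequence of vertices. -/
def copyOfTuple {V : Type*} {G : SimpleGraph V} {k : ℕ} (x : Fin k → V)
    (hx : Function.Injective x) (h : ∀ i j : Fin k, i.val + 1 = j.val → G.Adj (x i) (x j)) :
    SimpleGraph.Copy (SimpleGraph.pathGraph k) G :=
  ⟨⟨x, fun {i j} hij => by
    rcases SimpleGraph.pathGraph_adj.1 hij with h' | h'
    exacts [h i j h', (h j i h').symm]⟩, hx⟩

theorem card_copy_pathGraph {V : Type*} [Fintype V] (G : SimpleGraph V) (k : ℕ)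
    [Fintype (SimpleGraph.Copy (SimpleGraph.pathGraph k) G)] :
    Fintype.card (SimpleGraph.Copy (SimpleGraph.pathGraph k) G) = (pathTuples G k).card := by
  rw [← Finset.card_univ]
  refine Finset.card_bij (fun f _ => f) (fun f _ => ?_) (fun f _ g _ h => DFunLike.coe_injective h)
    (fun x hx => ?_)
  · exact mem_pathTuples.2 ⟨f.injective, fun i j h =>
      f.toHom.map_adj (SimpleGraph.pathGraph_adj.2 (Or.inl h))⟩
  · obtain ⟨h1, h2⟩ := mem_pathTuples.1 hx
    exact ⟨copyOfTuple x h1 h2, Finset.mem_univ _, rfl⟩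

theorem toSubgraph_adj_iff {V : Type*} {G : SimpleGraph V} {k : ℕ}
    (f : SimpleGraph.Copy (SimpleGraph.pathGraph k) G) (i j : Fin k) :
    f.toSubgraph.Adj (f i) (f j) ↔ (SimpleGraph.pathGraph k).Adj i j := by
  simp only [SimpleGraph.Subgraph.map_adj, Relation.Map]
  constructor
  · rintro ⟨a, b, hab, ha, hb⟩
    have ha' : a = i := f.injective ha
    have hb' : b = j := f.injective hb
    subst ha' hb'
    simpa using hab
  · intro h
    exact ⟨i, j, by simpa using h, rfl, rfl⟩

/-- The reversal of a labelled copy of a path has the same underlying subgraph. -/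
theorem exists_reverse_copy {V : Type*} {G : SimpleGraph V} {k : ℕ} (hk : 2 ≤ k)
    (f : SimpleGraph.Copy (SimpleGraph.pathGraph k) G) :
    ∃ g : SimpleGraph.Copy (SimpleGraph.pathGraph k) G, g ≠ f ∧ g.toSubgraph = f.toSubgraph := by
  have hrev : ∀ i j : Fin k, (SimpleGraph.pathGraph k).Adj i.rev j.rev ↔
      (SimpleGraph.pathGraph k).Adj i j := by
    intro i j
    simp only [SimpleGraph.pathGraph_adj, Fin.val_rev]
    omega
  let ρ : SimpleGraph.Copy (SimpleGraph.pathGraph k) (SimpleGraph.pathGraph k) :=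
    ⟨⟨Fin.rev, fun {i j} h => (hrev i j).2 h⟩, Fin.rev_injective⟩
  refine ⟨f.comp ρ, fun h => ?_, ?_⟩
  · have h0 := DFunLike.congr_fun h (⟨0, by omega⟩ : Fin k)
    have h1 : Fin.rev (⟨0, by omega⟩ : Fin k) = ⟨0, by omega⟩ := f.injective h0
    have := congrArg Fin.val h1
    simp only [Fin.val_rev] at this
    omega
  · ext v w
    · simp only [SimpleGraph.Subgraph.map_verts, SimpleGraph.Subgraph.verts_top, Set.image_univ,
        Set.mem_range]
      constructor
      · rintro ⟨i, rfl⟩; exact ⟨i.rev, rfl⟩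
      · rintro ⟨i, rfl⟩
        exact ⟨i.rev, congrArg f (Fin.rev_rev i)⟩
    · simp only [SimpleGraph.Subgraph.map_adj, Relation.Map, SimpleGraph.Subgraph.top_adj]
      constructor
      · rintro ⟨i, j, hij, rfl, rfl⟩
        exact ⟨i.rev, j.rev, (hrev i j).2 hij, rfl, rfl⟩
      · rintro ⟨i, j, hij, rfl, rfl⟩
        exact ⟨i.rev, j.rev, (hrev i j).2 hij, congrArg f (Fin.rev_rev i),
          congrArg f (Fin.rev_rev j)⟩

theorem two_mul_copyCount_le {V : Type*} [Fintype V] (G : SimpleGraph V) {k : ℕ} (hk : 2 ≤ k) :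
    2 * G.copyCount (SimpleGraph.pathGraph k) ≤ (pathTuples G k).card := by
  classical
  rw [← card_copy_pathGraph, SimpleGraph.copyCount_eq_card_image_copyToSubgraph,
    ← Finset.card_univ]
  refine Finset.mul_card_image_le_card _ 2 fun K hK => ?_
  obtain ⟨f, -, rfl⟩ := Finset.mem_image.1 hK
  obtain ⟨g, hg, he⟩ := exists_reverse_copy hk f
  have hsub : ({g, f} : Finset _) ⊆ Finset.univ.filter fun h => h.toSubgraph = f.toSubgraph := by
    intro h hh
    rw [Finset.mem_filter]
    refine ⟨Finset.mem_univ _, ?_⟩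
    rcases Finset.mem_insert.1 hh with rfl | hh
    · exact he
    · rw [Finset.mem_singleton.1 hh]
  exact (Finset.card_pair hg).ge.trans (Finset.card_le_card hsub)

/-- Two labelled copies of the path on seven vertices with the same underlying subgraph agree up to
reversal. -/
theorem eq_or_reverse_of_toSubgraph_eq {V : Type*} {G : SimpleGraph V}
    (f g : SimpleGraph.Copy (SimpleGraph.pathGraph 7) G) (h : g.toSubgraph = f.toSubgraph) :
    (∀ i, g i = f i) ∨ ∀ i, g i = f i.rev := by
  have hex : ∀ i, ∃ j, f j = g i := by
    intro i
    have : g i ∈ g.toSubgraph.verts := by simp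
    rw [h] at this
    simpa using this
  choose σ hσ using hex
  have hadj : ∀ i j : Fin 7, i.val + 1 = j.val →
      (σ i).val + 1 = (σ j).val ∨ (σ j).val + 1 = (σ i).val := by
    intro i j hij
    have h1 := (toSubgraph_adj_iff g i j).2 (SimpleGraph.pathGraph_adj.2 (Or.inl hij))
    rw [h, ← hσ, ← hσ, toSubgraph_adj_iff] at h1
    exact SimpleGraph.pathGraph_adj.1 h1
  have hinj : ∀ i j : Fin 7, i ≠ j → (σ i).val ≠ (σ j).val := by
    intro i j hij he
    exact hij (g.injective ((hσ i).symm.trans ((congrArg f (Fin.ext he)).trans (hσ j))))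
  have a0 := hadj 0 1 rfl
  have a1 := hadj 1 2 rfl
  have a2 := hadj 2 3 rfl
  have a3 := hadj 3 4 rfl
  have a4 := hadj 4 5 rfl
  have a5 := hadj 5 6 rfl
  have n0 := hinj 0 2 (by decide)
  have n1 := hinj 1 3 (by decide)
  have n2 := hinj 2 4 (by decide)
  have n3 := hinj 3 5 (by decide)
  have n4 := hinj 4 6 (by decide)
  have b0 := (σ 0).isLt
  have b6 := (σ 6).isLt
  rcases a0 with a0 | a0
  · left
    have c1 : (σ 2).val = (σ 0).val + 2 := by omega
    have c2 : (σ 3).val = (σ 0).val + 3 := by omega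
    have c3 : (σ 4).val = (σ 0).val + 4 := by omega
    have c4 : (σ 5).val = (σ 0).val + 5 := by omega
    have c5 : (σ 6).val = (σ 0).val + 6 := by omega
    intro i
    rw [← hσ i]
    congr 1
    apply Fin.ext
    fin_cases i <;> simp <;> omega
  · right
    have c1 : (σ 2).val + 2 = (σ 0).val := by omega
    have c2 : (σ 3).val + 3 = (σ 0).val := by omega
    have c3 : (σ 4).val + 4 = (σ 0).val := by omega
    have c4 : (σ 5).val + 5 = (σ 0).val := by omega
    have c5 : (σ 6).val + 6 = (σ 0).val := by omega
    intro i
    rw [← hσ i]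
    congr 1
    apply Fin.ext
    fin_cases i <;> simp <;> omega

theorem card_pathTuples_seven_le {V : Type*} [Fintype V] (G : SimpleGraph V) :
    (pathTuples G 7).card ≤ 2 * G.copyCount (SimpleGraph.pathGraph 7) := by
  classical
  rw [← card_copy_pathGraph, SimpleGraph.copyCount_eq_card_image_copyToSubgraph,
    ← Finset.card_univ]
  refine Finset.card_le_mul_card_image _ 2 fun K hK => ?_
  obtain ⟨f, -, rfl⟩ := Finset.mem_image.1 hK
  obtain ⟨r, hne, hr⟩ := exists_reverse_copy (by norm_num) f
  refine le_trans (Finset.card_le_card (t := {f, r}) fun g hg => ?_) Finset.card_le_two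
  simp only [Finset.mem_filter, Finset.mem_univ, true_and] at hg
  rw [Finset.mem_insert, Finset.mem_singleton]
  rcases eq_or_reverse_of_toSubgraph_eq f g hg with h | h
  · exact Or.inl (DFunLike.ext _ _ h)
  · rcases eq_or_reverse_of_toSubgraph_eq f r hr with h' | h'
    · exact absurd (DFunLike.ext _ _ h') hne
    · exact Or.inr (DFunLike.ext _ _ fun i => (h i).trans (h' i).symm)

/-! ### Sums over paths in a weighted graph -/

/-- The total weight, over all injective sequences `y₁, …, y_k` in `U`, of the path
`x, y₁, …, y_k`; the weight of a path is the product of the weights of its edges. -/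
noncomputable def pathSum {V : Type*} [DecidableEq V] (μ : V → V → ℝ) : ℕ → Finset V → V → ℝ
  | 0, _, _ => 1
  | k + 1, U, x => ∑ y ∈ U, μ x y * pathSum μ k (U.erase y) y

/-- Twice the total weight of the edges inside `U`. -/
def innerWeight {V : Type*} (μ : V → V → ℝ) (U : Finset V) : ℝ := ∑ x ∈ U, ∑ y ∈ U, μ x y

theorem innerWeight_insert {V : Type*} [DecidableEq V] {μ : V → V → ℝ}
    (hsymm : ∀ x y, μ x y = μ y x) (hdiag : ∀ x, μ x x = 0) {U : Finset V} {x : V} (hx : x ∉ U) :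
    innerWeight μ (insert x U) = innerWeight μ U + 2 * ∑ y ∈ U, μ x y := by
  simp only [innerWeight, Finset.sum_insert hx, Finset.sum_add_distrib, hdiag]
  rw [Finset.sum_congr rfl fun y _ => hsymm y x]
  ring

theorem innerWeight_nonneg {V : Type*} {μ : V → V → ℝ} (hμ : ∀ x y, 0 ≤ μ x y) (U : Finset V) :
    0 ≤ innerWeight μ U :=
  Finset.sum_nonneg fun _ _ => Finset.sum_nonneg fun _ _ => hμ _ _

theorem pow_add_mul_pow_le {a b : ℝ} (ha : 0 ≤ a) (hb : 0 ≤ b) (k : ℕ) :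
    b ^ (k + 1) + (k + 1) * a * b ^ k ≤ (a + b) ^ (k + 1) := by
  induction k with
  | zero => simp [add_comm]
  | succ k ih =>
    have h1 := mul_le_mul_of_nonneg_left ih (add_nonneg ha hb)
    have h2 : 0 ≤ (k + 1) * a ^ 2 * b ^ k := by positivity
    push_cast
    calc b ^ (k + 1 + 1) + (k + 1 + 1) * a * b ^ (k + 1)
        ≤ (a + b) * (b ^ (k + 1) + (k + 1) * a * b ^ k) := by
          ring_nf at h2 ⊢; linarith
      _ ≤ (a + b) ^ (k + 1 + 1) := by rw [pow_succ' _ (k + 1)]; exact h1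

/-- If the edges have total weight `M`, then the paths with `k ≥ 2` edges that start at a given
vertex have total weight at most `M ^ k / (2 * k !)`. The first edge uses up the weight `a` of the
edges at the first vertex, and the rest of the path lies in a graph of weight `M - a`. -/
theorem pathSum_le {V : Type*} [DecidableEq V] {μ : V → V → ℝ} (hμ : ∀ x y, 0 ≤ μ x y)
    (hsymm : ∀ x y, μ x y = μ y x) (hdiag : ∀ x, μ x x = 0) (k : ℕ) (U : Finset V) (x : V)
    (hx : x ∉ U) :
    2 * (k + 2).factorial * pathSum μ (k + 2) U x ≤ (innerWeight μ (insert x U) / 2) ^ (k + 2) := by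
  have step : ∀ (l : ℕ) (c : ℝ) (U : Finset V) (x : V), x ∉ U →
      (∀ y ∈ U, c * pathSum μ l (U.erase y) y ≤ (innerWeight μ U / 2) ^ l) →
      c * pathSum μ (l + 1) U x ≤ (∑ y ∈ U, μ x y) * (innerWeight μ U / 2) ^ l := by
    intro l c U x hx h
    rw [pathSum, Finset.mul_sum, Finset.sum_mul]
    refine Finset.sum_le_sum fun y hy => ?_
    calc c * (μ x y * pathSum μ l (U.erase y) y) = μ x y * (c * pathSum μ l (U.erase y) y) := by
          ring
      _ ≤ _ := mul_le_mul_of_nonneg_left (h y hy) (hμ _ _)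
  have ha : ∀ (U : Finset V) (x : V), 0 ≤ ∑ y ∈ U, μ x y :=
    fun U x => Finset.sum_nonneg fun y _ => hμ x y
  have hw : ∀ U : Finset V, 0 ≤ innerWeight μ U / 2 :=
    fun U => div_nonneg (innerWeight_nonneg hμ U) zero_le_two
  have one : ∀ (U : Finset V) (x : V), x ∉ U →
      pathSum μ 1 U x ≤ innerWeight μ (insert x U) / 2 := by
    intro U x hx
    rw [innerWeight_insert hsymm hdiag hx]
    have := hw U
    simp only [pathSum, mul_one]
    linarith
  induction k generalizing U x with
  | zero =>
    have h := step 1 1 U x hx fun y hy => by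
      have := one (U.erase y) y (Finset.notMem_erase y U)
      rw [Finset.insert_erase hy] at this
      linarith
    rw [innerWeight_insert hsymm hdiag hx]
    norm_num at h ⊢
    nlinarith [sq_nonneg (∑ y ∈ U, μ x y - innerWeight μ U / 2)]
  | succ k ih =>
    have h := step (k + 2) (2 * (k + 2).factorial) U x hx fun y hy => by
      have := ih (U.erase y) y (Finset.notMem_erase y U)
      rwa [Finset.insert_erase hy] at this
    have h2 := pow_add_mul_pow_le (ha U x) (hw U) (k + 2)
    have h3 : 0 ≤ (innerWeight μ U / 2) ^ (k + 2 + 1) := pow_nonneg (hw U) _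
    have h4 := mul_le_mul_of_nonneg_left h (by positivity : (0 : ℝ) ≤ (k : ℝ) + 3)
    rw [innerWeight_insert hsymm hdiag hx, add_div, mul_div_cancel_left₀ _ two_ne_zero,
      add_comm (innerWeight μ U / 2), show k + 1 + 2 = (k + 2) + 1 from rfl, Nat.factorial_succ]
    push_cast at h2 ⊢
    calc 2 * (((k : ℝ) + 2 + 1) * ((k + 2).factorial : ℝ)) * pathSum μ (k + 2 + 1) U x
        = (k + 3) * (2 * ((k + 2).factorial : ℝ) * pathSum μ (k + 2 + 1) U x) := by ring
      _ ≤ _ := h4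
      _ ≤ (∑ y ∈ U, μ x y + innerWeight μ U / 2) ^ (k + 2 + 1) := by
        refine le_trans ?_ h2
        linarith

/-- The injective sequences of length `k` in the finite set `U`. -/
noncomputable def injTuples {V : Type*} [Fintype V] (k : ℕ) (U : Finset V) : Finset (Fin k → V) := by
  classical exact Finset.univ.filter fun b => Function.Injective b ∧ ∀ i, b i ∈ U

theorem mem_injTuples {V : Type*} [Fintype V] {k : ℕ} {U : Finset V} {b : Fin k → V} :
    b ∈ injTuples k U ↔ Function.Injective b ∧ ∀ i, b i ∈ U := by
  simp [injTuples]

theorem sum_injTuples_succ {V : Type*} [Fintype V] [DecidableEq V] (k : ℕ) (U : Finset V)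
    (h : (Fin (k + 1) → V) → ℝ) :
    ∑ b ∈ injTuples (k + 1) U, h b
      = ∑ x ∈ U, ∑ b ∈ injTuples k (U.erase x), h (Fin.cons x b) := by
  rw [Finset.sum_sigma']
  symm
  refine Finset.sum_bij (fun p _ => Fin.cons p.1 p.2) ?_ ?_ ?_ ?_
  · rintro ⟨x, b⟩ hp
    obtain ⟨hx, hb⟩ := Finset.mem_sigma.1 hp
    obtain ⟨hinj, hU⟩ := mem_injTuples.1 hb
    refine mem_injTuples.2 ⟨Fin.cons_injective_iff.2 ⟨?_, hinj⟩, ?_⟩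
    · rintro ⟨i, hi⟩
      exact Finset.ne_of_mem_erase (hU i) hi
    · intro i
      induction i using Fin.cases with
      | zero => exact hx
      | succ i => exact Finset.mem_of_mem_erase (hU i)
  · rintro ⟨x, b⟩ - ⟨x', b'⟩ - h
    obtain ⟨rfl, rfl⟩ := Fin.cons_injective2 h
    rfl
  · intro b hb
    obtain ⟨hinj, hU⟩ := mem_injTuples.1 hb
    refine ⟨⟨b 0, Fin.tail b⟩, Finset.mem_sigma.2 ⟨hU 0, mem_injTuples.2 ⟨?_, ?_⟩⟩,
      Fin.cons_self_tail b⟩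
    · exact hinj.comp (Fin.succ_injective k)
    · intro i
      exact Finset.mem_erase.2 ⟨fun h => Fin.succ_ne_zero i (hinj h), hU _⟩
  · rintro ⟨x, b⟩ -
    rfl

theorem sum_injTuples_eq_pathSum {V : Type*} [Fintype V] [DecidableEq V] (μ : V → V → ℝ) (k : ℕ)
    (U : Finset V) (g : V → ℝ) :
    ∑ b ∈ injTuples (k + 1) U, g (b 0) * ∏ i : Fin k, μ (b i.castSucc) (b i.succ)
      = ∑ x ∈ U, g x * pathSum μ k (U.erase x) x := by
  induction k generalizing U g with
  | zero =>
    rw [sum_injTuples_succ]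
    refine Finset.sum_congr rfl fun x _ => ?_
    have : injTuples 0 (U.erase x) = {Fin.elim0} := by
      ext b
      simp only [mem_injTuples, Finset.mem_singleton]
      exact ⟨fun _ => Subsingleton.elim _ _,
        fun _ => ⟨fun i => i.elim0, fun i => i.elim0⟩⟩
    rw [this]
    simp [pathSum]
  | succ k ih =>
    rw [sum_injTuples_succ]
    refine Finset.sum_congr rfl fun x _ => ?_
    rw [pathSum, ← ih (U.erase x) (fun y => μ x y), Finset.mul_sum]
    refine Finset.sum_congr rfl fun b _ => ?_
    rw [Fin.prod_univ_succ]
    rfl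

/-! ### The weighted count for paths on seven vertices -/

/-- A symmetric weight: the edges that meet `{x, z}` have together at most the total weight. -/
theorem row_add_row_le {V : Type*} [Fintype V] [DecidableEq V] {w : V → V → ℝ}
    (hw : ∀ x y, 0 ≤ w x y) (hsymm : ∀ x y, w x y = w y x) (hdiag : ∀ x, w x x = 0)
    {x z : V} (hxz : x ≠ z) :
    ∑ y, w x y + ∑ y, w z y ≤ (∑ u, ∑ v, w u v) / 2 + w x z := by
  have h1 : ∑ y, w x y + (∑ y, w z y + ∑ u ∈ Finset.univ \ {x, z}, (w u x + w u z))
      ≤ ∑ u, ∑ v, w u v := by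
    rw [← Finset.sum_sdiff (Finset.subset_univ ({x, z} : Finset V)) (f := fun u => ∑ v, w u v),
      Finset.sum_pair hxz]
    have : ∑ u ∈ Finset.univ \ {x, z}, (w u x + w u z)
        ≤ ∑ u ∈ Finset.univ \ {x, z}, ∑ v, w u v := by
      refine Finset.sum_le_sum fun u _ => ?_
      rw [← Finset.sum_pair (f := fun v => w u v) hxz]
      exact Finset.sum_le_sum_of_subset_of_nonneg (Finset.subset_univ _) fun v _ _ => hw u v
    linarith
  have h2 : ∀ t, ∑ u ∈ Finset.univ \ {x, z}, w u t = ∑ y, w t y - w x t - w z t := by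
    intro t
    have h := Finset.sum_sdiff (Finset.subset_univ ({x, z} : Finset V)) (f := fun u => w u t)
    have h' : ∑ u, w u t = ∑ y, w t y := Finset.sum_congr rfl fun u _ => hsymm u t
    rw [Finset.sum_pair hxz] at h
    linarith
  rw [Finset.sum_add_distrib, h2, h2] at h1
  have := hdiag x
  have := hdiag z
  have := hsymm z x
  linarith

/-- The two edges from a common neighbour to `x` and `z` are bounded in terms of squares. -/
theorem sum_mul_le_sq {V : Type*} [Fintype V] [DecidableEq V] {μ : V → V → ℝ}
    (hsymm : ∀ x y, μ x y = μ y x) (hdiag : ∀ x, μ x x = 0) {x z : V} (hxz : x ≠ z) :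
    ∑ y, μ x y * μ y z ≤ ((∑ u, ∑ v, μ u v ^ 2) / 2 - μ x z ^ 2) / 2 := by
  have h := row_add_row_le (w := fun x y => μ x y ^ 2) (fun _ _ => sq_nonneg _)
    (fun x y => by rw [hsymm]) (fun x => by simp [hdiag]) hxz
  have hS := Finset.sum_sdiff (Finset.subset_univ ({x, z} : Finset V))
    (f := fun y => μ x y * μ y z)
  have h1 := Finset.sum_sdiff (Finset.subset_univ ({x, z} : Finset V)) (f := fun y => μ x y ^ 2)
  have h2 := Finset.sum_sdiff (Finset.subset_univ ({x, z} : Finset V)) (f := fun y => μ z y ^ 2)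
  rw [Finset.sum_pair hxz] at hS h1 h2
  have hle : ∑ y ∈ Finset.univ \ {x, z}, μ x y * μ y z ≤
      ∑ y ∈ Finset.univ \ {x, z}, (μ x y ^ 2 / 2 + μ z y ^ 2 / 2) := by
    refine Finset.sum_le_sum fun y _ => ?_
    rw [hsymm z y]
    nlinarith [sq_nonneg (μ x y - μ y z)]
  rw [Finset.sum_add_distrib, ← Finset.sum_div, ← Finset.sum_div] at hle
  rw [hdiag x, hdiag z] at hS
  rw [hdiag x] at h1
  rw [hdiag z, hsymm z x] at h2
  linarith

/-- Let `μ` be a weight of total mass at most one on the edges of a complete graph, and let `d`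
exceed the weighted degree. If `d x + d z ≤ 1 + μ x z`, then the sum of
`d x * μ x y * μ y z * d z` over all paths `x, y, z` is at most `8 / 27`, the value for the uniform
weight on a triangle.

After `d x * d z ≤ ((1 + μ x z) / 2) ^ 2`, the sum is bounded by `(1 + Q) ^ 2 * (1 - Q) / 4` where
`Q` is the sum of the squares of the weights of the edges. -/
theorem weighted_path_sum_le {V : Type*} [Fintype V] [DecidableEq V] {μ : V → V → ℝ} {d : V → ℝ}
    (hμ : ∀ x y, 0 ≤ μ x y) (hsymm : ∀ x y, μ x y = μ y x) (hdiag : ∀ x, μ x x = 0)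
    (hd : ∀ x, ∑ y, μ x y ≤ d x) (hdd : ∀ x z, x ≠ z → d x + d z ≤ 1 + μ x z)
    (hM : ∑ x, ∑ y, μ x y ≤ 2) :
    ∑ x, ∑ y, ∑ z, (if x = z then 0 else d x * μ x y * μ y z * d z) ≤ 8 / 27 := by
  have hd0 : ∀ x, 0 ≤ d x := fun x => (Finset.sum_nonneg fun y _ => hμ x y).trans (hd x)
  set Q := (∑ u, ∑ v, μ u v ^ 2) / 2 with hQ
  set R := (∑ u, ∑ v, μ u v ^ 3) / 2 with hR
  set T := (∑ u, ∑ v, μ u v ^ 4) / 2 with hT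
  set M := (∑ u, ∑ v, μ u v) / 2 with hMdef
  have hM1 : M ≤ 1 := by rw [hMdef]; linarith
  have hQ0 : 0 ≤ Q := by rw [hQ]; positivity
  have hT0 : 0 ≤ T := by rw [hT]; positivity
  have hR0 : 0 ≤ R :=
    div_nonneg (Finset.sum_nonneg fun u _ => Finset.sum_nonneg fun v _ => pow_nonneg (hμ u v) 3)
      zero_le_two
  -- the sum over paths without the factors at the ends
  have hcherry : ∑ x, ∑ y, ∑ z, (if x = z then 0 else μ x y * μ y z) ≤ 1 - Q := by
    have e1 : ∀ x y, ∑ z, (if x = z then 0 else μ x y * μ y z)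
        = μ x y * (∑ z, μ y z) - μ x y ^ 2 := by
      intro x y
      have : ∀ z, (if x = z then 0 else μ x y * μ y z)
          = μ x y * μ y z - if x = z then μ x y * μ y z else 0 := by
        intro z; split_ifs <;> ring
      simp only [this, Finset.sum_sub_distrib, ← Finset.mul_sum, Finset.sum_ite_eq,
        Finset.mem_univ, if_true]
      rw [hsymm y x]; ring
    have e2 : ∑ x, ∑ y, μ x y * ∑ z, μ y z = ∑ x, ∑ y, μ x y * ∑ z, μ x z := by
      rw [Finset.sum_comm]
      refine Finset.sum_congr rfl fun y _ => Finset.sum_congr rfl fun x _ => ?_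
      rw [hsymm x y]
    have e3 : ∑ x, ∑ y, μ x y * (∑ z, μ x z + ∑ z, μ y z) ≤ ∑ x, ∑ y, (μ x y + μ x y ^ 2) := by
      refine Finset.sum_le_sum fun x _ => Finset.sum_le_sum fun y _ => ?_
      by_cases hxy : x = y
      · subst hxy; simp [hdiag]
      · have := hd x
        have := hd y
        have := hdd x y hxy
        nlinarith [hμ x y]
    simp only [mul_add, Finset.sum_add_distrib] at e3
    simp only [e1, Finset.sum_sub_distrib]
    linarith
  have hW : ∀ x z, x ≠ z → ∑ y, μ x y * μ y z ≤ (Q - μ x z ^ 2) / 2 :=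
    fun x z h => sum_mul_le_sq hsymm hdiag h
  have hclosed : ∀ p : ℕ, ∑ x, ∑ z, μ x z ^ (p + 1) * ∑ y, μ x y * μ y z
      ≤ ∑ x, ∑ z, (Q / 2 * μ x z ^ (p + 1) - μ x z ^ (p + 3) / 2) := by
    intro p
    refine Finset.sum_le_sum fun x _ => Finset.sum_le_sum fun z _ => ?_
    by_cases hxz : x = z
    · subst hxz; simp [hdiag]
    · calc _ ≤ μ x z ^ (p + 1) * ((Q - μ x z ^ 2) / 2) :=
            mul_le_mul_of_nonneg_left (hW x z hxz) (pow_nonneg (hμ _ _) _)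
        _ = _ := by ring
  have h1 := hclosed 0
  have h2 := hclosed 1
  simp only [Finset.sum_sub_distrib, ← Finset.mul_sum, ← Finset.sum_div] at h1 h2
  norm_num at h1 h2
  -- the closing edge of the path enters through `d x * d z ≤ ((1 + μ x z) / 2) ^ 2`
  have hmain : ∑ x, ∑ y, ∑ z, (if x = z then 0 else d x * μ x y * μ y z * d z) ≤
      (∑ x, ∑ y, ∑ z, (if x = z then 0 else μ x y * μ y z)) / 4
      + (∑ x, ∑ z, μ x z * ∑ y, μ x y * μ y z) / 2
      + (∑ x, ∑ z, μ x z ^ 2 * ∑ y, μ x y * μ y z) / 4 := by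
    have swap : ∀ p : ℕ, ∑ x, ∑ z, μ x z ^ p * ∑ y, μ x y * μ y z
        = ∑ x, ∑ y, ∑ z, μ x z ^ p * (μ x y * μ y z) := by
      intro p
      simp only [Finset.mul_sum]
      exact Finset.sum_congr rfl fun x _ => Finset.sum_comm
    have s1 := swap 1
    have s2 := swap 2
    simp only [pow_one] at s1
    rw [s1, s2]
    simp only [Finset.sum_div, ← Finset.sum_add_distrib]
    refine Finset.sum_le_sum fun x _ => Finset.sum_le_sum fun y _ => Finset.sum_le_sum fun z _ => ?_
    split_ifs with h
    · subst h; simp [hdiag]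
    · have hz : d x * d z ≤ ((1 + μ x z) / 2) ^ 2 := by
        have := hdd x z h
        nlinarith [sq_nonneg (d x - d z), hd0 x, hd0 z]
      have hp := mul_le_mul_of_nonneg_left hz (mul_nonneg (hμ x y) (hμ y z))
      linarith
  have hQR : Q ^ 2 ≤ R := by
    have hcs := Finset.sum_sq_le_sum_mul_sum_of_sq_le_mul (Finset.univ : Finset (V × V))
      (r := fun p => μ p.1 p.2 ^ 2) (f := fun p => μ p.1 p.2) (g := fun p => μ p.1 p.2 ^ 3)
      (fun p _ => hμ _ _) (fun p _ => pow_nonneg (hμ _ _) _) (fun p _ => le_of_eq (by ring))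
    simp only [Fintype.sum_prod_type] at hcs
    have : (2 * Q) ^ 2 ≤ (2 * M) * (2 * R) := by
      rw [hQ, hMdef, hR]; linarith
    nlinarith
  have hRT : R ^ 2 ≤ Q * T := by
    have hcs := Finset.sum_sq_le_sum_mul_sum_of_sq_le_mul (Finset.univ : Finset (V × V))
      (r := fun p => μ p.1 p.2 ^ 3) (f := fun p => μ p.1 p.2 ^ 2) (g := fun p => μ p.1 p.2 ^ 4)
      (fun p _ => sq_nonneg _) (fun p _ => pow_nonneg (hμ _ _) _) (fun p _ => le_of_eq (by ring))
    simp only [Fintype.sum_prod_type] at hcs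
    have : (2 * R) ^ 2 ≤ (2 * Q) * (2 * T) := by
      rw [hQ, hT, hR]; linarith
    nlinarith
  have hQT : Q ^ 3 ≤ T := by
    rcases hQ0.eq_or_lt with h | h
    · rw [← h]; simpa using hT0
    · have h4 : (Q ^ 2) ^ 2 ≤ R ^ 2 := pow_le_pow_left₀ (sq_nonneg Q) hQR 2
      have : Q * Q ^ 3 ≤ Q * T := by nlinarith
      exact le_of_mul_le_mul_left this h
  have e1 : ∑ u, ∑ v, μ u v = 2 * M := by rw [hMdef]; ring
  have e2 : ∑ u, ∑ v, μ u v ^ 2 = 2 * Q := by rw [hQ]; ring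
  have e3 : ∑ u, ∑ v, μ u v ^ 3 = 2 * R := by rw [hR]; ring
  have e4 : ∑ u, ∑ v, μ u v ^ 4 = 2 * T := by rw [hT]; ring
  rw [e1, e3] at h1
  rw [e2, e4] at h2
  have hQM : Q * M ≤ Q := by nlinarith
  have hfinal : (1 + Q) ^ 2 * (1 - Q) ≤ 32 / 27 := by
    nlinarith [mul_nonneg (sq_nonneg (Q - 1 / 3)) (by linarith : (0 : ℝ) ≤ Q + 5 / 3)]
  nlinarith

/-! ### Paths that leave the hubs -/

section Counting

variable {V : Type*}

/-- A matching of the path `x 0, …, x (2 * m)` that misses only `x (2 * t)`. -/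
def matchingAround (m t : ℕ) (x : Fin (2 * m + 1) → V) (i : Fin m) : V × V :=
  if i.val < t then (x ⟨2 * i, by omega⟩, x ⟨2 * i + 1, by omega⟩)
  else (x ⟨2 * i + 1, by omega⟩, x ⟨2 * i + 2, by omega⟩)

theorem matchingAround_injective {m t : ℕ} (ht : t ≤ m) {x y : Fin (2 * m + 1) → V}
    (h : matchingAround m t x = matchingAround m t y)
    (h0 : x ⟨2 * t, by omega⟩ = y ⟨2 * t, by omega⟩) : x = y := by
  have hlt : ∀ i : Fin m, i.val < t → x ⟨2 * i, by omega⟩ = y ⟨2 * i, by omega⟩ ∧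
      x ⟨2 * i + 1, by omega⟩ = y ⟨2 * i + 1, by omega⟩ := by
    intro i hi
    have := congrFun h i
    simpa only [matchingAround, if_pos hi, Prod.mk.injEq] using this
  have hge : ∀ i : Fin m, ¬ i.val < t → x ⟨2 * i + 1, by omega⟩ = y ⟨2 * i + 1, by omega⟩ ∧
      x ⟨2 * i + 2, by omega⟩ = y ⟨2 * i + 2, by omega⟩ := by
    intro i hi
    have := congrFun h i
    simpa only [matchingAround, if_neg hi, Prod.mk.injEq] using this
  funext ⟨j, hj⟩
  rcases Nat.even_or_odd' j with ⟨c, rfl | rfl⟩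
  · rcases lt_trichotomy c t with hc | rfl | hc
    · exact (hlt ⟨c, by omega⟩ hc).1
    · exact h0
    · obtain ⟨c, rfl⟩ : ∃ c', c = c' + 1 := ⟨c - 1, by omega⟩
      exact (hge ⟨c, by omega⟩ (by simp; omega)).2
  · by_cases hc : c < t
    · exact (hlt ⟨c, by omega⟩ hc).2
    · exact (hge ⟨c, by omega⟩ hc).1

variable [Fintype V]

/-- Paths on `2 * m + 1` vertices for which the vertex at position `2 * t` is one of at most `K`
vertices once the others are known: the others are covered by `m` disjoint edges. -/
theorem card_le_dartCount_pow_mul (G : SimpleGraph V) {m t K : ℕ} (ht : t ≤ m)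
    (S : Finset (Fin (2 * m + 1) → V)) (hS : S ⊆ pathTuples G (2 * m + 1))
    (A : (Fin m → V × V) → Finset V) (hA : ∀ p, (A p).card ≤ K)
    (h : ∀ x ∈ S, x ⟨2 * t, by omega⟩ ∈ A (matchingAround m t x)) :
    S.card ≤ dartCount G ^ m * K := by
  classical
  let E : Finset (V × V) := Finset.univ.filter fun p : V × V => G.Adj p.1 p.2
  have hE : E.card = dartCount G := by rw [dartCount]
  have hcard : S.card ≤ ((Fintype.piFinset fun _ : Fin m => E).sigma A).card := by
    refine Finset.card_le_card_of_injOn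
      (fun x => ⟨matchingAround m t x, x ⟨2 * t, by omega⟩⟩) ?_ ?_
    · intro x hx
      refine Finset.mem_sigma.2 ⟨Fintype.mem_piFinset.2 fun i => ?_, h x hx⟩
      have hadj := (mem_pathTuples.1 (hS hx)).2
      simp only [E, Finset.mem_filter, Finset.mem_univ, true_and, matchingAround]
      split_ifs <;> exact hadj _ _ rfl
    · intro x _ y _ hxy
      obtain ⟨h1, h2⟩ := Sigma.mk.inj_iff.1 hxy
      exact matchingAround_injective ht h1 (eq_of_heq h2)
  refine hcard.trans ?_
  rw [Finset.card_sigma]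
  refine (Finset.sum_le_card_nsmul _ _ K fun p _ => hA p).trans ?_
  rw [Fintype.card_piFinset_const, hE, smul_eq_mul]

open Classical in
/-- The vertices of degree greater than `K`. -/
noncomputable def hubs (G : SimpleGraph V) (K : ℕ) : Finset V :=
  Finset.univ.filter fun v => K < (Finset.univ.filter fun w => G.Adj v w).card

open Classical in
/-- The vertices with at most two neighbours in `B`. -/
noncomputable def sparseVerts (G : SimpleGraph V) (B : Finset V) : Finset V :=
  Finset.univ.filter fun v => (B.filter fun w => G.Adj w v).card ≤ 2

open Classical in
/-- The labelled paths on `2 * m + 1` vertices that alternate between `B` and its sparse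
neighbours. -/
noncomputable def alternatingTuples (G : SimpleGraph V) (B : Finset V) (m : ℕ) :
    Finset (Fin (2 * m + 1) → V) :=
  (pathTuples G (2 * m + 1)).filter fun x =>
    (∀ i : Fin m, x ⟨2 * i + 1, by omega⟩ ∈ B) ∧
      ∀ i : Fin (m + 1), x ⟨2 * i, by omega⟩ ∈ sparseVerts G B

/-- A path that does not alternate between hubs and sparse vertices is exceptional at some position:
it continues from a vertex of small degree, or it contains a vertex that is not sparse. -/
theorem card_pathTuples_le [DecidableEq V] (G : SimpleGraph V) (K m : ℕ) :
    (pathTuples G (2 * m + 1)).card ≤ (alternatingTuples G (hubs G K) m).card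
      + m * (dartCount G ^ m * K)
      + (m + 1) * (dartCount G ^ m * (sparseVerts G (hubs G K))ᶜ.card) := by
  classical
  set B := hubs G K with hB
  let E₁ : Fin m → Finset (Fin (2 * m + 1) → V) := fun i =>
    (pathTuples G (2 * m + 1)).filter fun x => x ⟨2 * i + 1, by omega⟩ ∉ B
  let E₂ : Fin (m + 1) → Finset (Fin (2 * m + 1) → V) := fun i =>
    (pathTuples G (2 * m + 1)).filter fun x => x ⟨2 * i, by omega⟩ ∈ (sparseVerts G B)ᶜ
  have hE₁ : ∀ i, (E₁ i).card ≤ dartCount G ^ m * K := by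
    intro i
    refine card_le_dartCount_pow_mul G (t := i + 1) i.2 (E₁ i) (Finset.filter_subset _ _)
      (fun p => if (p i).2 ∈ B then ∅ else Finset.univ.filter fun w => G.Adj (p i).2 w)
      (fun p => ?_) (fun x hx => ?_)
    · split_ifs with h
      · simp
      · simpa [hB, hubs] using h
    · obtain ⟨hx, hxB⟩ := Finset.mem_filter.1 hx
      have hp : (matchingAround m (i + 1) x i).2 = x ⟨2 * i + 1, by omega⟩ := by
        simp [matchingAround]
      rw [hp, if_neg hxB, Finset.mem_filter]
      exact ⟨Finset.mem_univ _, (mem_pathTuples.1 hx).2 _ _ rfl⟩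
  have hE₂ : ∀ i, (E₂ i).card ≤ dartCount G ^ m * (sparseVerts G B)ᶜ.card := by
    intro i
    exact card_le_dartCount_pow_mul G (t := i) (Nat.lt_succ_iff.1 i.2) (E₂ i)
      (Finset.filter_subset _ _) (fun _ => (sparseVerts G B)ᶜ) (fun _ => le_rfl)
      (fun x hx => (Finset.mem_filter.1 hx).2)
  have hsub : pathTuples G (2 * m + 1) ⊆ (alternatingTuples G B m ∪ Finset.univ.biUnion E₁) ∪
      Finset.univ.biUnion E₂ := by
    intro x hx
    simp only [Finset.mem_union, Finset.mem_biUnion, Finset.mem_univ, true_and, alternatingTuples,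
      E₁, E₂, Finset.mem_filter, hx, Finset.mem_compl]
    by_cases h1 : ∀ i : Fin m, x ⟨2 * i + 1, by omega⟩ ∈ B
    · by_cases h2 : ∀ i : Fin (m + 1), x ⟨2 * i, by omega⟩ ∈ sparseVerts G B
      · exact Or.inl (Or.inl ⟨h1, h2⟩)
      · push Not at h2; exact Or.inr h2
    · push Not at h1; exact Or.inl (Or.inr h1)
  refine (Finset.card_le_card hsub).trans ((Finset.card_union_le _ _).trans
    (Nat.add_le_add ((Finset.card_union_le _ _).trans (Nat.add_le_add le_rfl ?_)) ?_))
  · refine Finset.card_biUnion_le.trans ((Finset.sum_le_card_nsmul _ _ _ fun i _ => hE₁ i).trans ?_)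
    simp
  · refine Finset.card_biUnion_le.trans ((Finset.sum_le_card_nsmul _ _ _ fun i _ => hE₂ i).trans ?_)
    simp

/-! ### Alternating paths as weighted paths on the hubs -/

open Classical in
/-- The number of sparse neighbours of `x`. -/
noncomputable def sparseDeg (G : SimpleGraph V) (B : Finset V) (x : V) : ℕ :=
  ((sparseVerts G B).filter fun v => G.Adj x v).card

open Classical in
/-- The number of sparse common neighbours of `x` and `y`. -/
noncomputable def sparseCodeg (G : SimpleGraph V) (B : Finset V) (x y : V) : ℕ :=
  ((sparseVerts G B).filter fun v => G.Adj x v ∧ G.Adj y v).card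

open Classical in
theorem card_alternatingTuples_le (G : SimpleGraph V) (B : Finset V) (k : ℕ) :
    (alternatingTuples G B (k + 1)).card ≤ ∑ b ∈ injTuples (k + 1) B,
      sparseDeg G B (b 0) * (∏ i : Fin k, sparseCodeg G B (b i.castSucc) (b i.succ)) *
        sparseDeg G B (b (Fin.last k)) := by
  -- the possible vertices of the path at position `2 * j`, for given hubs `b`
  let C : (Fin (k + 1) → V) → Fin (k + 2) → Finset V := fun b j =>
    (sparseVerts G B).filter fun v =>
      ∀ i : Fin (k + 1), i.val = j.val ∨ i.val + 1 = j.val → G.Adj (b i) v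
  have hcard : (alternatingTuples G B (k + 1)).card ≤
      ((injTuples (k + 1) B).sigma fun b => Fintype.piFinset (C b)).card := by
    refine Finset.card_le_card_of_injOn
      (fun x => ⟨fun i => x ⟨2 * i + 1, by omega⟩, fun j => x ⟨2 * j, by omega⟩⟩) ?_ ?_
    · intro x hx
      obtain ⟨hx, hxB, hxS⟩ := Finset.mem_filter.1 hx
      obtain ⟨hinj, hadj⟩ := mem_pathTuples.1 hx
      refine Finset.mem_sigma.2 ⟨mem_injTuples.2 ⟨fun i j hij => ?_, hxB⟩,
        Fintype.mem_piFinset.2 fun j => Finset.mem_filter.2 ⟨hxS j, fun i hij => ?_⟩⟩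
      · have := congrArg Fin.val (hinj hij)
        exact Fin.ext (by simpa using this)
      · rcases hij with hij | hij
        · exact (hadj _ _ (by simp [hij])).symm
        · exact hadj _ _ (by simp; omega)
    · intro x _ y _ hxy
      obtain ⟨h1, h2⟩ := Sigma.mk.inj_iff.1 hxy
      have h2 := eq_of_heq h2
      funext ⟨j, hj⟩
      rcases Nat.even_or_odd' j with ⟨c, rfl | rfl⟩
      · exact congrFun h2 ⟨c, by omega⟩
      · exact congrFun h1 ⟨c, by omega⟩
  refine hcard.trans ?_
  rw [Finset.card_sigma]
  refine Finset.sum_le_sum fun b _ => ?_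
  rw [Fintype.card_piFinset, Fin.prod_univ_succ, Fin.prod_univ_castSucc, ← mul_assoc]
  refine Nat.mul_le_mul (Nat.mul_le_mul ?_ (Finset.prod_le_prod' fun i _ => ?_)) ?_
  · refine Finset.card_le_card fun v hv => ?_
    obtain ⟨h1, h2⟩ := Finset.mem_filter.1 hv
    exact Finset.mem_filter.2 ⟨h1, h2 0 (Or.inl rfl)⟩
  · refine Finset.card_le_card fun v hv => ?_
    obtain ⟨h1, h2⟩ := Finset.mem_filter.1 hv
    exact Finset.mem_filter.2 ⟨h1, h2 _ (Or.inr (by simp)), h2 _ (Or.inl (by simp))⟩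
  · refine Finset.card_le_card fun v hv => ?_
    obtain ⟨h1, h2⟩ := Finset.mem_filter.1 hv
    exact Finset.mem_filter.2 ⟨h1, h2 _ (Or.inr (by simp))⟩

theorem sparseDeg_le (G : SimpleGraph V) (B : Finset V) (x : V) :
    sparseDeg G B x ≤ Fintype.card V :=
  (Finset.card_le_univ _)

theorem sparseCodeg_comm (G : SimpleGraph V) (B : Finset V) (x y : V) :
    sparseCodeg G B x y = sparseCodeg G B y x := by
  unfold sparseCodeg
  congr 1
  ext v
  simp [and_comm]

theorem sparseDeg_add_le (G : SimpleGraph V) (B : Finset V) (x z : V) :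
    sparseDeg G B x + sparseDeg G B z ≤ Fintype.card V + sparseCodeg G B x z := by
  classical
  rw [sparseDeg, sparseDeg, sparseCodeg, Finset.filter_and, ← Finset.card_union_add_card_inter]
  exact Nat.add_le_add_right (Finset.card_le_univ _) _

theorem sum_sparseDeg_le (G : SimpleGraph V) (B : Finset V) :
    ∑ x ∈ B, sparseDeg G B x ≤ 2 * Fintype.card V := by
  classical
  have h := Finset.sum_card_bipartiteAbove_eq_sum_card_bipartiteBelow (s := B)
    (t := sparseVerts G B) (fun x v => G.Adj x v)
  calc ∑ x ∈ B, sparseDeg G B x = ∑ v ∈ sparseVerts G B, (B.filter fun w => G.Adj w v).card := h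
    _ ≤ (sparseVerts G B).card • 2 :=
        Finset.sum_le_card_nsmul _ _ _ fun v hv => (Finset.mem_filter.1 hv).2
    _ ≤ _ := by
        rw [smul_eq_mul, mul_comm]
        exact Nat.mul_le_mul_left 2 (Finset.card_le_univ _)

open Classical in
/-- A sparse neighbour of the hub `x` has at most one further neighbour among the hubs. -/
theorem sum_sparseCodeg_le (G : SimpleGraph V) (B : Finset V) {x : V} (hx : x ∈ B) :
    ∑ y ∈ B.erase x, sparseCodeg G B x y ≤ sparseDeg G B x := by
  have h := Finset.sum_card_bipartiteAbove_eq_sum_card_bipartiteBelow (s := B.erase x)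
    (t := (sparseVerts G B).filter fun v => G.Adj x v) (fun y v => G.Adj y v)
  calc ∑ y ∈ B.erase x, sparseCodeg G B x y
      = ∑ v ∈ (sparseVerts G B).filter (fun v => G.Adj x v),
        ((B.erase x).filter fun w => G.Adj w v).card := by
          rw [← Finset.sum_congr rfl fun y _ => ?_]
          · exact h
          · rw [sparseCodeg, Finset.bipartiteAbove, Finset.filter_filter]
    _ ≤ ((sparseVerts G B).filter fun v => G.Adj x v).card • 1 := by
        refine Finset.sum_le_card_nsmul _ _ _ fun v hv => ?_
        obtain ⟨hv, hxv⟩ := Finset.mem_filter.1 hv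
        have h2 := (Finset.mem_filter.1 hv).2
        have he : (B.erase x).filter (fun w => G.Adj w v)
            = (B.filter fun w => G.Adj w v).erase x := by
          ext w; simp [and_assoc]
        rw [he, Finset.card_erase_of_mem (Finset.mem_filter.2 ⟨hx, hxv⟩)]
        omega
    _ = sparseDeg G B x := by rw [smul_eq_mul, mul_one, sparseDeg]

end Counting

section Weights

variable {V : Type*} [Fintype V]

open Classical in
/-- The weight of a pair of hubs: the proportion of vertices that are sparse common neighbours. -/
noncomputable def hubWeight (G : SimpleGraph V) (B : Finset V) (x y : V) : ℝ :=
  if x ≠ y ∧ x ∈ B ∧ y ∈ B then (sparseCodeg G B x y : ℝ) / Fintype.card V else 0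

theorem hubWeight_nonneg (G : SimpleGraph V) (B : Finset V) (x y : V) : 0 ≤ hubWeight G B x y := by
  unfold hubWeight; split_ifs <;> positivity

theorem hubWeight_symm (G : SimpleGraph V) (B : Finset V) (x y : V) :
    hubWeight G B x y = hubWeight G B y x := by
  unfold hubWeight
  rw [sparseCodeg_comm]
  congr 1
  simp only [ne_comm, and_comm]

theorem hubWeight_self (G : SimpleGraph V) (B : Finset V) (x : V) : hubWeight G B x x = 0 := by
  simp [hubWeight]

open Classical in
theorem sum_hubWeight_row (G : SimpleGraph V) (B : Finset V) {x : V} (hx : x ∈ B) :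
    ∑ y, hubWeight G B x y = (∑ y ∈ B.erase x, sparseCodeg G B x y : ℕ) / Fintype.card V := by
  push_cast
  rw [Finset.sum_div, ← Finset.sum_filter_add_sum_filter_not Finset.univ (· ∈ B.erase x)]
  have h0 : ∑ y ∈ Finset.univ.filter (fun y => ¬ y ∈ B.erase x), hubWeight G B x y = 0 := by
    refine Finset.sum_eq_zero fun y hy => ?_
    have hy := (Finset.mem_filter.1 hy).2
    rw [hubWeight, if_neg]
    rintro ⟨h1, -, h3⟩
    exact hy (Finset.mem_erase.2 ⟨h1.symm, h3⟩)
  rw [h0, add_zero]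
  have he : Finset.univ.filter (fun y => y ∈ B.erase x) = B.erase x := by ext; simp
  rw [he]
  refine Finset.sum_congr rfl fun y hy => ?_
  rw [hubWeight, if_pos ⟨(Finset.ne_of_mem_erase hy).symm, hx, Finset.mem_of_mem_erase hy⟩]

theorem sum_hubWeight_row_of_notMem (G : SimpleGraph V) (B : Finset V) {x : V} (hx : x ∉ B) :
    ∑ y, hubWeight G B x y = 0 :=
  Finset.sum_eq_zero fun y _ => by rw [hubWeight, if_neg fun h => hx h.2.1]

theorem sum_hubWeight_row_le (G : SimpleGraph V) (B : Finset V) {x : V} (hx : x ∈ B) :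
    ∑ y, hubWeight G B x y ≤ sparseDeg G B x / Fintype.card V := by
  classical
  rw [sum_hubWeight_row G B hx]
  gcongr
  exact_mod_cast sum_sparseCodeg_le G B hx

theorem sum_hubWeight_le (G : SimpleGraph V) (B : Finset V) (hV : 0 < Fintype.card V) :
    ∑ x, ∑ y, hubWeight G B x y ≤ 2 := by
  classical
  have hV' : (0 : ℝ) < Fintype.card V := by exact_mod_cast hV
  have h1 : ∑ x, ∑ y, hubWeight G B x y = ∑ x ∈ B, ∑ y, hubWeight G B x y :=
    (Finset.sum_subset (Finset.subset_univ B) fun x _ hx =>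
      sum_hubWeight_row_of_notMem G B hx).symm
  calc ∑ x, ∑ y, hubWeight G B x y ≤ ∑ x ∈ B, (sparseDeg G B x : ℝ) / Fintype.card V := by
        rw [h1]; exact Finset.sum_le_sum fun x hx => sum_hubWeight_row_le G B hx
    _ ≤ 2 := by
        rw [← Finset.sum_div, div_le_iff₀ hV']
        exact_mod_cast sum_sparseDeg_le G B

theorem card_alternatingTuples_le_weighted (G : SimpleGraph V) (B : Finset V) (k : ℕ)
    (hV : 0 < Fintype.card V) :
    ((alternatingTuples G B (k + 1)).card : ℝ) ≤ (Fintype.card V : ℝ) ^ k *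
      ∑ b ∈ injTuples (k + 1) B, (sparseDeg G B (b 0) : ℝ) *
        (∏ i : Fin k, hubWeight G B (b i.castSucc) (b i.succ)) * sparseDeg G B (b (Fin.last k)) := by
  have hV' : (Fintype.card V : ℝ) ≠ 0 := by exact_mod_cast hV.ne'
  have h := card_alternatingTuples_le G B k
  have h' := (Nat.cast_le (α := ℝ)).2 h
  refine h'.trans_eq ?_
  push_cast
  rw [Finset.mul_sum]
  refine Finset.sum_congr rfl fun b hb => ?_
  obtain ⟨hinj, hB⟩ := mem_injTuples.1 hb
  have hprod : ∏ i : Fin k, (sparseCodeg G B (b i.castSucc) (b i.succ) : ℝ)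
      = (Fintype.card V : ℝ) ^ k * ∏ i : Fin k, hubWeight G B (b i.castSucc) (b i.succ) := by
    rw [← Fin.prod_const, ← Finset.prod_mul_distrib]
    refine Finset.prod_congr rfl fun i _ => ?_
    rw [hubWeight, if_pos ⟨fun h => (Fin.castSucc_lt_succ (i := i)).ne (hinj h), hB _, hB _⟩,
      mul_div_cancel₀ _ hV']
  rw [hprod]
  ring

theorem card_alternatingTuples_le_factorial (G : SimpleGraph V) (B : Finset V) (k : ℕ)
    (hV : 0 < Fintype.card V) :
    ((alternatingTuples G B (k + 3)).card : ℝ) ≤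
      (Fintype.card V : ℝ) ^ (k + 4) / (k + 2).factorial := by
  classical
  set n : ℝ := (Fintype.card V : ℝ) with hn
  have hn0 : 0 < n := by rw [hn]; exact_mod_cast hV
  have hW : innerWeight (hubWeight G B) B / 2 ≤ 1 := by
    have : innerWeight (hubWeight G B) B ≤ ∑ x, ∑ y, hubWeight G B x y := by
      refine (Finset.sum_le_sum fun x _ => Finset.sum_le_sum_of_subset_of_nonneg
        (Finset.subset_univ B) fun y _ _ => hubWeight_nonneg G B x y).trans ?_
      exact Finset.sum_le_sum_of_subset_of_nonneg (Finset.subset_univ B) fun x _ _ =>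
        Finset.sum_nonneg fun y _ => hubWeight_nonneg G B x y
    linarith [sum_hubWeight_le G B hV]
  have hps : ∀ x ∈ B, pathSum (hubWeight G B) (k + 2) (B.erase x) x
      ≤ 1 / (2 * (k + 2).factorial) := by
    intro x hx
    have h := pathSum_le (hubWeight_nonneg G B) (hubWeight_symm G B) (hubWeight_self G B) k
      (B.erase x) x (Finset.notMem_erase x B)
    rw [Finset.insert_erase hx] at h
    rw [le_div_iff₀ (by positivity), mul_comm]
    exact h.trans (pow_le_one₀ (div_nonneg (innerWeight_nonneg (hubWeight_nonneg G B) B)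
      zero_le_two) hW)
  have hdeg : ∑ x ∈ B, (sparseDeg G B x : ℝ) ≤ 2 * n := by
    rw [hn]; exact_mod_cast sum_sparseDeg_le G B
  have hsum : ∑ b ∈ injTuples (k + 2 + 1) B, (sparseDeg G B (b 0) : ℝ) *
        (∏ i : Fin (k + 2), hubWeight G B (b i.castSucc) (b i.succ)) *
          sparseDeg G B (b (Fin.last (k + 2)))
      ≤ (∑ x ∈ B, (sparseDeg G B x : ℝ) *
          pathSum (hubWeight G B) (k + 2) (B.erase x) x) * n := by
    rw [← sum_injTuples_eq_pathSum, Finset.sum_mul]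
    refine Finset.sum_le_sum fun b _ => mul_le_mul_of_nonneg_left ?_ ?_
    · rw [hn]; exact_mod_cast sparseDeg_le G B _
    · exact mul_nonneg (Nat.cast_nonneg _)
        (Finset.prod_nonneg fun i _ => hubWeight_nonneg G B _ _)
  refine (card_alternatingTuples_le_weighted G B (k + 2) hV).trans ?_
  rw [← hn]
  calc n ^ (k + 2) * _ ≤ n ^ (k + 2) * ((2 * n * (1 / (2 * (k + 2).factorial))) * n) := by
        refine mul_le_mul_of_nonneg_left (hsum.trans (mul_le_mul_of_nonneg_right ?_ hn0.le))
          (by positivity)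
        refine (Finset.sum_le_sum fun x hx => mul_le_mul_of_nonneg_left (hps x hx)
          (Nat.cast_nonneg _)).trans ?_
        rw [← Finset.sum_mul]
        exact mul_le_mul_of_nonneg_right hdeg (by positivity)
    _ = n ^ (k + 4) / (k + 2).factorial := by field_simp; ring

theorem sum_injTuples_three_le [DecidableEq V] (B : Finset V) (h : (Fin 3 → V) → ℝ)
    (h0 : ∀ b, 0 ≤ h b) :
    ∑ b ∈ injTuples 3 B, h b ≤ ∑ x, ∑ y, ∑ z, if x = z then 0 else h ![x, y, z] := by
  have himg : ∑ b ∈ injTuples 3 B, h b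
      = ∑ p ∈ (injTuples 3 B).image fun b => (b 0, b 1, b 2),
        if p.1 = p.2.2 then 0 else h ![p.1, p.2.1, p.2.2] := by
    rw [Finset.sum_image]
    · refine Finset.sum_congr rfl fun b hb => ?_
      have hne : b 0 ≠ b 2 := fun h => absurd ((mem_injTuples.1 hb).1 h) (by decide)
      rw [if_neg hne]
      congr 1
      funext i
      fin_cases i <;> rfl
    · intro b _ b' _ hbb
      simp only [Prod.mk.injEq] at hbb
      funext i
      fin_cases i
      exacts [hbb.1, hbb.2.1, hbb.2.2]
  rw [himg]
  refine (Finset.sum_le_sum_of_subset_of_nonneg (Finset.subset_univ _) fun p _ _ => ?_).trans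
    (le_of_eq ?_)
  · split_ifs
    exacts [le_rfl, h0 _]
  · simp only [Fintype.sum_prod_type]

theorem card_alternatingTuples_three_le (G : SimpleGraph V) (B : Finset V)
    (hV : 0 < Fintype.card V) :
    ((alternatingTuples G B 3).card : ℝ) ≤ 8 / 27 * (Fintype.card V : ℝ) ^ 4 := by
  classical
  have hmain := card_alternatingTuples_le_weighted G B 2 hV
  set n : ℝ := (Fintype.card V : ℝ) with hn
  have hn0 : 0 < n := by rw [hn]; exact_mod_cast hV
  let d : V → ℝ := fun x => if x ∈ B then (sparseDeg G B x : ℝ) / n else 0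
  have hd1 : ∀ x, d x ≤ 1 := by
    intro x
    simp only [d]
    split_ifs
    · rw [div_le_one hn0, hn]; exact_mod_cast sparseDeg_le G B x
    · exact zero_le_one
  have hw := weighted_path_sum_le (d := d) (hubWeight_nonneg G B) (hubWeight_symm G B)
    (hubWeight_self G B) ?_ ?_ (sum_hubWeight_le G B hV)
  · have hsum : ∑ b ∈ injTuples 3 B, (sparseDeg G B (b 0) : ℝ) *
        (∏ i : Fin 2, hubWeight G B (b i.castSucc) (b i.succ)) * sparseDeg G B (b (Fin.last 2))
        = n ^ 2 * ∑ b ∈ injTuples 3 B, d (b 0) * hubWeight G B (b 0) (b 1) *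
          hubWeight G B (b 1) (b 2) * d (b 2) := by
      rw [Finset.mul_sum]
      refine Finset.sum_congr rfl fun b hb => ?_
      have hB := (mem_injTuples.1 hb).2
      simp only [d, if_pos (hB _), Fin.prod_univ_two]
      field_simp
      rfl
    have hle := sum_injTuples_three_le B (fun b => d (b 0) * hubWeight G B (b 0) (b 1) *
      hubWeight G B (b 1) (b 2) * d (b 2)) fun b => by
        have hd0 : ∀ x, 0 ≤ d x := fun x => by simp only [d]; split_ifs <;> positivity
        exact mul_nonneg (mul_nonneg (mul_nonneg (hd0 _) (hubWeight_nonneg _ _ _ _))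
          (hubWeight_nonneg _ _ _ _)) (hd0 _)
    have hle' := hle.trans hw
    rw [hsum] at hmain
    nlinarith [pow_pos hn0 4, mul_le_mul_of_nonneg_left hle' (pow_pos hn0 4).le]
  · intro x
    by_cases hx : x ∈ B
    · simp only [d, if_pos hx]; exact sum_hubWeight_row_le G B hx
    · simp only [d, if_neg hx]; exact (sum_hubWeight_row_of_notMem G B hx).le
  · intro x z hxz
    by_cases hx : x ∈ B
    · by_cases hz : z ∈ B
      · rw [hubWeight, if_pos ⟨hxz, hx, hz⟩, ← hn]
        simp only [d, if_pos hx, if_pos hz]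
        rw [← add_div, ← div_self hn0.ne', ← add_div, div_le_div_iff_of_pos_right hn0]
        rw [hn]; exact_mod_cast sparseDeg_add_le G B x z
      · have : d z = 0 := by simp only [d, if_neg hz]
        linarith [hd1 x, hubWeight_nonneg G B x z]
    · have : d x = 0 := by simp only [d, if_neg hx]
      linarith [hd1 z, hubWeight_nonneg G B x z]

end Weights

/-! ### The upper bound for planar graphs -/

open Classical in
theorem mul_card_hubs_le {V : Type*} [Fintype V] (G : SimpleGraph V) (K : ℕ) :
    (K + 1) * (hubs G K).card ≤ dartCount G := by
  rw [dartCount_eq_sum, mul_comm, ← smul_eq_mul]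
  refine (Finset.card_nsmul_le_sum (hubs G K)
    (fun v => (Finset.univ.filter fun w => G.Adj v w).card) (K + 1)
    fun v hv => (Finset.mem_filter.1 hv).2).trans ?_
  exact Finset.sum_le_sum_of_subset (Finset.subset_univ _)

/-- In a planar graph each triple of hubs has at most two common neighbours, so few vertices have
three neighbours among the hubs. -/
theorem IsPlanar.card_compl_sparseVerts_le {n : ℕ} {G : SimpleGraph (Fin n)} (hG : IsPlanar G)
    (B : Finset (Fin n)) : (sparseVerts G B)ᶜ.card ≤ 2 * B.card ^ 3 := by
  classical
  have hex : ∀ v, ∃ f : Fin 3 → Fin n, v ∈ (sparseVerts G B)ᶜ →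
      Function.Injective f ∧ (∀ i, f i ∈ B) ∧ ∀ i, G.Adj (f i) v := by
    intro v
    by_cases hv : v ∈ (sparseVerts G B)ᶜ
    · have h3 : 3 ≤ (B.filter fun w => G.Adj w v).card := by
        simpa [sparseVerts, Nat.succ_le_iff] using hv
      obtain ⟨g⟩ : Nonempty (Fin 3 ↪ (B.filter fun w => G.Adj w v)) :=
        Function.Embedding.nonempty_of_card_le (by rwa [Fintype.card_fin, Fintype.card_coe])
      exact ⟨fun i => g i, fun _ => ⟨Subtype.val_injective.comp g.injective,
        fun i => (Finset.mem_filter.1 (g i).2).1, fun i => (Finset.mem_filter.1 (g i).2).2⟩⟩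
    · exact ⟨fun _ => v, fun h => absurd h hv⟩
  choose f hf using hex
  have h := Finset.card_le_mul_card_image_of_maps_to (f := f) (s := (sparseVerts G B)ᶜ)
    (t := Fintype.piFinset fun _ : Fin 3 => B)
    (fun v hv => Fintype.mem_piFinset.2 fun i => (hf v hv).2.1 i) 2 (fun b _ => ?_)
  · rwa [Fintype.card_piFinset_const] at h
  · by_cases hne : ((sparseVerts G B)ᶜ.filter fun v => f v = b).Nonempty
    · obtain ⟨v, hv⟩ := hne
      obtain ⟨hv', rfl⟩ := Finset.mem_filter.1 hv
      refine hG.card_common_le ⟨f v, (hf v hv').1⟩ _ fun w hw i => ?_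
      obtain ⟨hw, hwv⟩ := Finset.mem_filter.1 hw
      change G.Adj (f v i) w
      rw [← hwv]
      exact (hf w hw).2.2 i
    · rw [Finset.not_nonempty_iff_eq_empty.1 hne]; simp

/-- With hubs of degree greater than `n ^ (4 / 5)`, all paths but `O(n ^ (m + 4 / 5))` alternate
between hubs and sparse vertices. -/
theorem IsPlanar.card_pathTuples_le {n : ℕ} (hn : 0 < n) {G : SimpleGraph (Fin n)}
    (hG : IsPlanar G) (m : ℕ) :
    ((pathTuples G (2 * m + 1)).card : ℝ) ≤
      (alternatingTuples G (hubs G ⌊(n : ℝ) ^ ((4 : ℝ) / 5)⌋₊) m).card +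
      32 ^ m * (65537 * m + 65536) * (n : ℝ) ^ ((m : ℝ) + 4 / 5) := by
  set K := ⌊(n : ℝ) ^ ((4 : ℝ) / 5)⌋₊ with hK
  have hn0 : (0 : ℝ) < n := by exact_mod_cast hn
  have hn1 : (1 : ℝ) ≤ n := by exact_mod_cast hn
  have h := _root_.card_pathTuples_le G K m
  have hD : (dartCount G : ℝ) ≤ 32 * n := by exact_mod_cast hG.dartCount_le
  have hKle : (K : ℝ) ≤ (n : ℝ) ^ ((4 : ℝ) / 5) := Nat.floor_le (by positivity)
  have hB : ((hubs G K).card : ℝ) ≤ 32 * (n : ℝ) ^ ((1 : ℝ) / 5) := by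
    have h1 : ((K : ℝ) + 1) * (hubs G K).card ≤ 32 * n := by
      refine le_trans ?_ hD
      exact_mod_cast mul_card_hubs_le G K
    have h2 : (n : ℝ) ^ ((4 : ℝ) / 5) ≤ K + 1 := (Nat.lt_floor_add_one _).le
    have h3 : (n : ℝ) = (n : ℝ) ^ ((4 : ℝ) / 5) * (n : ℝ) ^ ((1 : ℝ) / 5) := by
      rw [← Real.rpow_add hn0]; norm_num
    have h4 : (0 : ℝ) < (n : ℝ) ^ ((4 : ℝ) / 5) := by positivity
    refine le_of_mul_le_mul_left ?_ h4
    calc (n : ℝ) ^ ((4 : ℝ) / 5) * (hubs G K).card ≤ (K + 1) * (hubs G K).card :=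
          mul_le_mul_of_nonneg_right h2 (Nat.cast_nonneg _)
      _ ≤ 32 * n := h1
      _ = _ := by nth_rewrite 1 [h3]; ring
  have hS : ((sparseVerts G (hubs G K))ᶜ.card : ℝ) ≤ 65536 * (n : ℝ) ^ ((4 : ℝ) / 5) := by
    have h1 : ((sparseVerts G (hubs G K))ᶜ.card : ℝ) ≤ 2 * ((hubs G K).card : ℝ) ^ 3 := by
      exact_mod_cast hG.card_compl_sparseVerts_le (hubs G K)
    have h2 : ((hubs G K).card : ℝ) ^ 3 ≤ (32 * (n : ℝ) ^ ((1 : ℝ) / 5)) ^ 3 :=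
      pow_le_pow_left₀ (Nat.cast_nonneg _) hB 3
    have h3 : ((n : ℝ) ^ ((1 : ℝ) / 5)) ^ 3 ≤ (n : ℝ) ^ ((4 : ℝ) / 5) := by
      rw [← Real.rpow_mul_natCast hn0.le]
      exact Real.rpow_le_rpow_of_exponent_le hn1 (by norm_num)
    rw [mul_pow] at h2
    linarith
  have hDm : (dartCount G : ℝ) ^ m ≤ (32 * n) ^ m := pow_le_pow_left₀ (Nat.cast_nonneg _) hD m
  have hpow : (n : ℝ) ^ ((m : ℝ) + 4 / 5) = (n : ℝ) ^ m * (n : ℝ) ^ ((4 : ℝ) / 5) := by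
    rw [Real.rpow_add hn0, Real.rpow_natCast]
  have h' := (Nat.cast_le (α := ℝ)).2 h
  push_cast at h'
  have e1 : (dartCount G : ℝ) ^ m * K ≤ (32 * n) ^ m * (n : ℝ) ^ ((4 : ℝ) / 5) :=
    mul_le_mul hDm hKle (Nat.cast_nonneg _) (by positivity)
  have e2 : (dartCount G : ℝ) ^ m * ((sparseVerts G (hubs G K))ᶜ.card : ℝ) ≤
      (32 * n) ^ m * (65536 * (n : ℝ) ^ ((4 : ℝ) / 5)) :=
    mul_le_mul hDm hS (Nat.cast_nonneg _) (by positivity)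
  have e1' := mul_le_mul_of_nonneg_left e1 (Nat.cast_nonneg (α := ℝ) m)
  have e2' := mul_le_mul_of_nonneg_left e2 (by positivity : (0 : ℝ) ≤ (m : ℝ) + 1)
  rw [mul_pow] at e1' e2'
  rw [hpow]
  linarith

theorem IsPlanar.copyCount_le {n : ℕ} (hn : 0 < n) {G : SimpleGraph (Fin n)}
    (hG : IsPlanar G) (m : ℕ) (hm : 1 ≤ m) (c : ℝ)
    (hc : ∀ B : Finset (Fin n), ((alternatingTuples G B m).card : ℝ) ≤ c) :
    (G.copyCount (SimpleGraph.pathGraph (2 * m + 1)) : ℝ) ≤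
      c / 2 + 32 ^ m * (65537 * m + 65536) * (n : ℝ) ^ ((m : ℝ) + 4 / 5) := by
  have h1 : (2 : ℝ) * G.copyCount (SimpleGraph.pathGraph (2 * m + 1)) ≤
      (pathTuples G (2 * m + 1)).card := by
    exact_mod_cast two_mul_copyCount_le G (k := 2 * m + 1) (by omega)
  have h2 := hG.card_pathTuples_le hn m
  have h3 := hc (hubs G ⌊(n : ℝ) ^ ((4 : ℝ) / 5)⌋₊)
  have h4 : 0 ≤ 32 ^ m * (65537 * m + 65536) * (n : ℝ) ^ ((m : ℝ) + 4 / 5) := by positivity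
  linarith

theorem maxPlanarCopies_path_seven_le {n : ℕ} (hn : 0 < n) :
    (maxPlanarCopies n (SimpleGraph.pathGraph 7) : ℝ) ≤ 4 / 27 * (n : ℝ) ^ 4 +
      32 ^ 3 * (65537 * 3 + 65536) * (n : ℝ) ^ ((4 : ℝ) - 1 / 5) := by
  obtain ⟨G, hG, hk⟩ := (maxPlanarCopies_isGreatest n (SimpleGraph.pathGraph 7)).1
  rw [← hk]
  refine (hG.copyCount_le hn 3 (by norm_num) _ fun B =>
    card_alternatingTuples_three_le G B (by simpa using hn)).trans (le_of_eq ?_)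
  rw [Fintype.card_fin]
  norm_num
  ring

theorem maxPlanarCopies_path_odd_le {n : ℕ} (hn : 0 < n) {m : ℕ} (hm : 3 ≤ m) :
    (maxPlanarCopies n (SimpleGraph.pathGraph (2 * m + 1)) : ℝ) ≤
      (n : ℝ) ^ (m + 1) / (2 * ((m - 1).factorial : ℝ)) +
      32 ^ m * (65537 * m + 65536) * (n : ℝ) ^ ((m : ℝ) + 4 / 5) := by
  obtain ⟨k, rfl⟩ := Nat.exists_eq_add_of_le' hm
  obtain ⟨G, hG, hk⟩ :=
    (maxPlanarCopies_isGreatest n (SimpleGraph.pathGraph (2 * (k + 3) + 1))).1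
  rw [← hk]
  refine (hG.copyCount_le hn (k + 3) (by omega) _ fun B =>
    card_alternatingTuples_le_factorial G B k (by simpa using hn)).trans (le_of_eq ?_)
  rw [Fintype.card_fin, div_div, mul_comm (2 : ℝ)]
  rfl

/-! ### A planar graph with many paths on seven vertices -/

/-- First coordinates of the three vectors `(1, 0)`, `(0, 1)`, `(-1, -1)`. -/
def triX (i : ℕ) : ℝ := if i = 0 then 1 else if i = 1 then 0 else -1

/-- Second coordinates of the three vectors `(1, 0)`, `(0, 1)`, `(-1, -1)`. -/
def triY (i : ℕ) : ℝ := if i = 0 then 0 else if i = 1 then 1 else -1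

/-- The six sectors between a vector of the triple and the opposite of another one have disjoint
interiors, so the coordinates of a point with respect to its sector are unique. -/
theorem sector_coordinates_unique {i g i' g' : ℕ} (hi : i < 3) (hg : g < 3) (hi' : i' < 3)
    (hg' : g' < 3) (hig : g ≠ i) (hig' : g' ≠ i') {α β α' β' : ℝ} (hα : 0 ≤ α) (hβ : 0 ≤ β)
    (hα' : 0 ≤ α') (hβ' : 0 ≤ β')
    (hX : α * triX i - β * triX g = α' * triX i' - β' * triX g')
    (hY : α * triY i - β * triY g = α' * triY i' - β' * triY g') :
    α = α' ∧ β = β' ∧ (α = 0 ∨ i = i') ∧ (β = 0 ∨ g = g') := by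
  interval_cases i <;> interval_cases g <;> (try (exact absurd rfl hig)) <;>
    interval_cases i' <;> interval_cases g' <;> (try (exact absurd rfl hig')) <;>
    norm_num [triX, triY] at hX hY ⊢ <;>
    (repeat' apply And.intro) <;> linarith

/-- The vertices of the drawing: three hubs at the vectors `triX`, `triY`, and every other vertex
`v` on the ray opposite to the hub `v % 3`. -/
noncomputable def triPoint (v : ℕ) : EuclideanSpace ℝ (Fin 2) :=
  if v < 3 then !₂[triX v, triY v] else !₂[-(v * triX (v % 3)), -(v * triY (v % 3))]

theorem lineMap_triPoint {a b : ℕ} (ha : a < 3) (hb : 3 ≤ b) (s : ℝ) :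
    AffineMap.lineMap (triPoint a) (triPoint b) s =
      !₂[(1 - s) * triX a - s * b * triX (b % 3), (1 - s) * triY a - s * b * triY (b % 3)] := by
  ext i
  rw [AffineMap.lineMap_apply_module, triPoint, triPoint, if_pos ha, if_neg (by omega)]
  fin_cases i <;> simp <;> ring

/-- Two straight edges of the drawing meet only in common ends. -/
theorem lineMap_triPoint_eq {a b a' b' : ℕ} (ha : a < 3) (hb : 3 ≤ b) (hab : b % 3 ≠ a)
    (ha' : a' < 3) (hb' : 3 ≤ b') (hab' : b' % 3 ≠ a') {s s' : ℝ} (hs : s ∈ Set.Icc (0 : ℝ) 1)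
    (hs' : s' ∈ Set.Icc (0 : ℝ) 1)
    (h : AffineMap.lineMap (triPoint a) (triPoint b) s
      = AffineMap.lineMap (triPoint a') (triPoint b') s') :
    (a = a' ∧ b = b' ∧ s = s') ∨ (a = a' ∧ s = 0 ∧ s' = 0) ∨ (b = b' ∧ s = 1 ∧ s' = 1) := by
  rw [lineMap_triPoint ha hb, lineMap_triPoint ha' hb'] at h
  have hX := congrArg (fun p : EuclideanSpace ℝ (Fin 2) => p 0) h
  have hY := congrArg (fun p : EuclideanSpace ℝ (Fin 2) => p 1) h
  simp at hX hY
  have hbpos : (0 : ℝ) < b := by exact_mod_cast (by omega : 0 < b)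
  have hb'pos : (0 : ℝ) < b' := by exact_mod_cast (by omega : 0 < b')
  obtain ⟨h1, h2, h3, -⟩ := sector_coordinates_unique ha (Nat.mod_lt b (by norm_num)) ha'
    (Nat.mod_lt b' (by norm_num)) hab hab' (by linarith [hs.2]) (mul_nonneg hs.1 hbpos.le)
    (by linarith [hs'.2]) (mul_nonneg hs'.1 hb'pos.le) hX hY
  have hss : s = s' := by linarith
  subst hss
  by_cases h0 : s = 0
  · right; left
    refine ⟨?_, h0, h0⟩
    rcases h3 with h3 | h3
    · exact absurd h3 (by rw [h0]; norm_num)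
    · exact h3
  · have hbb : b = b' := by exact_mod_cast mul_left_cancel₀ h0 h2
    rcases h3 with h3 | h3
    · exact Or.inr (Or.inr ⟨hbb, by linarith, by linarith⟩)
    · exact Or.inl ⟨h3, hbb, rfl⟩

/-- Each vertex is an end of a segment of the kind treated in `lineMap_triPoint_eq`. -/
theorem exists_segment_through (w : ℕ) : ∃ a b : ℕ, a < 3 ∧ 3 ≤ b ∧ b % 3 ≠ a ∧
    ((w = a ∧ triPoint w = AffineMap.lineMap (triPoint a) (triPoint b) (0 : ℝ)) ∨
      (w = b ∧ triPoint w = AffineMap.lineMap (triPoint a) (triPoint b) (1 : ℝ))) := by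
  by_cases hw : w < 3
  · exact ⟨w, 3 + (w + 1) % 3, hw, by omega, by omega, Or.inl ⟨rfl, by simp⟩⟩
  · exact ⟨(w + 1) % 3, w, by omega, by omega, by omega, Or.inr ⟨rfl, by simp⟩⟩

theorem triPoint_injective : Function.Injective triPoint := by
  intro v w h
  obtain ⟨a, b, ha, hb, hab, h1⟩ := exists_segment_through v
  obtain ⟨a', b', ha', hb', hab', h2⟩ := exists_segment_through w
  rcases h1 with ⟨e1, h1⟩ | ⟨e1, h1⟩ <;> rcases h2 with ⟨e2, h2⟩ | ⟨e2, h2⟩ <;>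
    rw [h1, h2] at h <;>
    have := lineMap_triPoint_eq ha hb hab ha' hb' hab' (by norm_num) (by norm_num) h <;>
    norm_num at this <;> omega

theorem eq_end_of_triPoint_mem {a b w : ℕ} (ha : a < 3) (hb : 3 ≤ b) (hab : b % 3 ≠ a) {s : ℝ}
    (hs : s ∈ Set.Icc (0 : ℝ) 1)
    (h : triPoint w = AffineMap.lineMap (triPoint a) (triPoint b) s) : w = a ∨ w = b := by
  obtain ⟨a', b', ha', hb', hab', h2⟩ := exists_segment_through w
  rcases h2 with ⟨e2, h2⟩ | ⟨e2, h2⟩ <;> rw [h2] at h <;>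
    have := lineMap_triPoint_eq ha' hb' hab' ha hb hab (by norm_num) hs h <;>
    norm_num at this <;> omega

/-- Three hubs `0`, `1`, `2`, and every other vertex `v` is joined to the two hubs different
from `v % 3`. -/
def triGraph (n : ℕ) : SimpleGraph (Fin n) where
  Adj u v := (u.val < 3 ∧ 3 ≤ v.val ∧ v.val % 3 ≠ u.val) ∨
    (v.val < 3 ∧ 3 ≤ u.val ∧ u.val % 3 ≠ v.val)
  symm := ⟨fun _ _ h => h.symm⟩
  loopless := ⟨fun u h => by rcases h with h | h <;> omega⟩

/-- An edge of `triGraph` joins a hub to a vertex that is not a hub. -/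
theorem triGraph_adj_cases {n : ℕ} {u v : Fin n} (h : (triGraph n).Adj u v) :
    ∃ a b : Fin n, a.val < 3 ∧ 3 ≤ b.val ∧ b.val % 3 ≠ a.val ∧ s(u, v) = s(a, b) ∧
      segment ℝ (triPoint u) (triPoint v) = segment ℝ (triPoint a) (triPoint b) := by
  rcases h with ⟨h1, h2, h3⟩ | ⟨h1, h2, h3⟩
  · exact ⟨u, v, h1, h2, h3, rfl, rfl⟩
  · exact ⟨v, u, h1, h2, h3, Sym2.eq_swap, segment_symm _ _ _⟩

theorem isPlanar_triGraph (n : ℕ) : IsPlanar (triGraph n) := by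
  refine ⟨{ point := fun v => triPoint v
            point_injective := triPoint_injective.comp Fin.val_injective
            arc := fun u v _ => Path.segment _ _
            arc_injective := fun u v h => ?_
            range_arc_symm := fun u v h => ?_
            arc_avoids_vertices := fun u v h w hw => ?_
            arc_inter_arc := fun u v x y h h' hne p hp => ?_ }⟩
  · intro s t hst
    have hne : triPoint u ≠ triPoint v := fun e =>
      h.ne (Fin.ext (triPoint_injective e))
    exact Path.segment_injective_of_ne hne hst
  · rw [Path.range_segment, Path.range_segment, segment_symm]
  · rw [Path.range_segment] at hw
    obtain ⟨a, b, ha, hb, hab, hs, hseg⟩ := triGraph_adj_cases h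
    rw [hseg, segment_eq_image_lineMap] at hw
    obtain ⟨s, hs01, hw⟩ := hw
    have hmem : w ∈ s(u, v) := by
      rw [hs, Sym2.mem_iff]
      exact (eq_end_of_triPoint_mem ha hb hab hs01 hw.symm).imp Fin.ext Fin.ext
    exact Sym2.mem_iff.1 hmem
  · rw [Path.range_segment, Path.range_segment] at hp
    obtain ⟨a, b, ha, hb, hab, hs, hseg⟩ := triGraph_adj_cases h
    obtain ⟨a', b', ha', hb', hab', hs', hseg'⟩ := triGraph_adj_cases h'
    rw [hseg, hseg', segment_eq_image_lineMap, segment_eq_image_lineMap] at hp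
    obtain ⟨⟨s, hs01, rfl⟩, s', hs01', he⟩ := hp
    rw [hs, hs'] at hne ⊢
    rcases lineMap_triPoint_eq ha hb hab ha' hb' hab' hs01 hs01' he.symm with
      ⟨e1, e2, -⟩ | ⟨e1, e2, -⟩ | ⟨e1, e2, -⟩
    · exact absurd (by rw [Fin.ext e1, Fin.ext e2]) hne
    · refine ⟨a, by simp, by simp [Fin.ext e1], by simp [e2]⟩
    · refine ⟨b, by simp, by simp [Fin.ext e1], by simp [e2]⟩

/-- The hub `g`, as a vertex of `triGraph n`. -/
def triHub {n q : ℕ} (hq : 3 * q + 3 ≤ n) (g : Fin 3) : Fin n := ⟨g, by omega⟩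

/-- The `j`-th vertex of `triGraph n` that is not joined to the hub `g`. -/
def triLow {n q : ℕ} (hq : 3 * q + 3 ≤ n) (g : Fin 3) (j : Fin q) : Fin n :=
  ⟨3 * (j + 1) + g, by omega⟩

theorem triGraph_adj_hub_low {n q : ℕ} (hq : 3 * q + 3 ≤ n) {h g : Fin 3} (hne : g.val ≠ h.val)
    (j : Fin q) : (triGraph n).Adj (triHub hq h) (triLow hq g j) := by
  refine Or.inl ⟨h.isLt, ?_, ?_⟩ <;> simp only [triHub, triLow] <;> omega

/-- The paths that visit the hubs `σ 0`, `σ 1`, `σ 2` in this order: four further vertices with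
pairwise distinct indices are placed at the ends and between the hubs, and at each end there are
two possible kinds of vertices. -/
def triTuple {n q : ℕ} (hq : 3 * q + 3 ≤ n)
    (p : Equiv.Perm (Fin 3) × Bool × Bool × (Fin 4 ↪ Fin q)) : Fin 7 → Fin n :=
  ![triLow hq (if p.2.1 then p.1 1 else p.1 2) (p.2.2.2 0), triHub hq (p.1 0),
    triLow hq (p.1 2) (p.2.2.2 1), triHub hq (p.1 1), triLow hq (p.1 0) (p.2.2.2 2),
    triHub hq (p.1 2), triLow hq (if p.2.2.1 then p.1 1 else p.1 0) (p.2.2.2 3)]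

theorem triTuple_mem {n q : ℕ} (hq : 3 * q + 3 ≤ n)
    (p : Equiv.Perm (Fin 3) × Bool × Bool × (Fin 4 ↪ Fin q)) :
    triTuple hq p ∈ pathTuples (triGraph n) 7 := by
  obtain ⟨σ, b, c, j⟩ := p
  have hσ : ∀ i k : Fin 3, i ≠ k → (σ i).val ≠ (σ k).val :=
    fun i k h e => h (σ.injective (Fin.ext e))
  have hj : ∀ i k : Fin 4, i ≠ k → (j i).val ≠ (j k).val :=
    fun i k h e => h (j.injective (Fin.ext e))
  have s01 := hσ 0 1 (by decide)
  have s02 := hσ 0 2 (by decide)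
  have s12 := hσ 1 2 (by decide)
  have j01 := hj 0 1 (by decide)
  have j02 := hj 0 2 (by decide)
  have j03 := hj 0 3 (by decide)
  have j12 := hj 1 2 (by decide)
  have j13 := hj 1 3 (by decide)
  have j23 := hj 2 3 (by decide)
  obtain ⟨g, hg, hg0⟩ : ∃ g, (if b then σ 1 else σ 2) = g ∧ g.val ≠ (σ 0).val := by
    cases b
    exacts [⟨_, rfl, s02.symm⟩, ⟨_, rfl, s01.symm⟩]
  obtain ⟨g', hg', hg2⟩ : ∃ g, (if c then σ 1 else σ 0) = g ∧ g.val ≠ (σ 2).val := by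
    cases c
    exacts [⟨_, rfl, s02⟩, ⟨_, rfl, s12⟩]
  rw [mem_pathTuples]
  simp only [triTuple, hg, hg']
  constructor
  · have l0 := (σ 0).isLt
    have l1 := (σ 1).isLt
    have l2 := (σ 2).isLt
    have l3 := g.isLt
    have l4 := g'.isLt
    rw [← List.nodup_ofFn]
    simp only [List.ofFn_succ, List.ofFn_zero, Fin.isValue, Matrix.cons_val_zero,
      Matrix.cons_val_succ, List.nodup_cons, List.mem_cons, List.not_mem_nil, Fin.ext_iff, triLow,
      triHub, List.nodup_nil, or_false, not_or, not_false_eq_true, and_true]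
    omega
  · intro x y hxy
    obtain ⟨k, rfl, rfl⟩ : ∃ k : Fin 6, x = k.castSucc ∧ y = k.succ :=
      ⟨⟨x, by omega⟩, rfl, Fin.ext hxy.symm⟩
    fin_cases k
    exacts [(triGraph_adj_hub_low hq hg0 _).symm, triGraph_adj_hub_low hq s02.symm _,
      (triGraph_adj_hub_low hq s12.symm _).symm, triGraph_adj_hub_low hq s01 _,
      (triGraph_adj_hub_low hq s02 _).symm, triGraph_adj_hub_low hq hg2 _]

theorem triTuple_injective {n q : ℕ} (hq : 3 * q + 3 ≤ n) :
    Function.Injective (triTuple (n := n) hq) := by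
  rintro ⟨σ, b, c, j⟩ ⟨σ', b', c', j'⟩ h
  have hlow : ∀ {g g' : Fin 3} {i i' : Fin q}, triLow hq g i = triLow hq g' i' → g = g' ∧ i = i' := by
    intro g g' i i' e
    have := congrArg Fin.val e
    simp only [triLow] at this
    exact ⟨Fin.ext (by omega), Fin.ext (by omega)⟩
  have hhub : ∀ {g g' : Fin 3}, triHub hq g = triHub hq g' → g = g' :=
    fun e => Fin.ext (Fin.mk.inj_iff.1 e)
  have h0 := hlow (congrFun h 0)
  have h1 := hhub (congrFun h 1)
  have h2 := hlow (congrFun h 2)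
  have h3 := hhub (congrFun h 3)
  have h4 := hlow (congrFun h 4)
  have h5 := hhub (congrFun h 5)
  have h6 := hlow (congrFun h 6)
  have hσ : σ = σ' := by
    refine Equiv.ext fun i => ?_
    fin_cases i
    exacts [h1, h3, h5]
  have hj : j = j' := by
    refine DFunLike.ext _ _ fun i => ?_
    fin_cases i
    exacts [h0.2, h2.2, h4.2, h6.2]
  subst hσ hj
  have s01 : σ 0 ≠ σ 1 := fun h => absurd (σ.injective h) (by decide)
  have s12 : σ 1 ≠ σ 2 := fun h => absurd (σ.injective h) (by decide)
  have hb : b = b' := by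
    cases b <;> cases b'
    exacts [rfl, absurd h0.1.symm s12, absurd h0.1 s12, rfl]
  have hc : c = c' := by
    cases c <;> cases c'
    exacts [rfl, absurd h6.1 s01, absurd h6.1.symm s01, rfl]
  rw [hb, hc]

theorem le_maxPlanarCopies_path_seven {n q : ℕ} (hq : 3 * q + 3 ≤ n) :
    12 * q.descFactorial 4 ≤ maxPlanarCopies n (SimpleGraph.pathGraph 7) := by
  classical
  have h1 : 24 * q.descFactorial 4 ≤ (pathTuples (triGraph n) 7).card := by
    have h := Finset.card_le_card_of_injOn (s := Finset.univ) (triTuple (n := n) hq)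
      (fun p _ => triTuple_mem hq p) ((triTuple_injective hq).injOn)
    rw [Finset.card_univ, Fintype.card_prod, Fintype.card_prod, Fintype.card_prod,
      Fintype.card_perm, Fintype.card_embedding_eq, Fintype.card_bool, Fintype.card_fin,
      Fintype.card_fin, Fintype.card_fin] at h
    simp only [Nat.factorial] at h
    omega
  have h2 := card_pathTuples_seven_le (triGraph n)
  have h3 := (maxPlanarCopies_isGreatest n (SimpleGraph.pathGraph 7)).2
    ⟨triGraph n, isPlanar_triGraph n, rfl⟩
  omega

theorem le_maxPlanarCopies_path_seven_real {n : ℕ} (hn : 15 ≤ n) :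
    4 / 27 * (n : ℝ) ^ 4 - 9 * (n : ℝ) ^ 3 ≤ maxPlanarCopies n (SimpleGraph.pathGraph 7) := by
  have h1 := le_maxPlanarCopies_path_seven (n := n) (q := n / 3 - 1) (by omega)
  have h2 := Nat.pow_sub_le_descFactorial (n / 3 - 1) 4
  have h3 : n ≤ 3 * (n / 3 - 1 + 1 - 4) + 15 := by omega
  set t := n / 3 - 1 + 1 - 4
  have h4 : (12 : ℝ) * (t : ℝ) ^ 4 ≤ maxPlanarCopies n (SimpleGraph.pathGraph 7) := by
    exact_mod_cast (Nat.mul_le_mul_left 12 h2).trans h1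
  have h5 : ((n : ℝ) - 15) / 3 ≤ t := by
    have : (n : ℝ) ≤ 3 * t + 15 := by exact_mod_cast h3
    linarith
  have hn' : (15 : ℝ) ≤ n := by exact_mod_cast hn
  have h6 : (((n : ℝ) - 15) / 3) ^ 4 ≤ (t : ℝ) ^ 4 := pow_le_pow_left₀ (by linarith) h5 4
  have h7 : (n : ℝ) ^ 4 - 60 * (n : ℝ) ^ 3 ≤ ((n : ℝ) - 15) ^ 4 := by
    nlinarith [mul_nonneg (by positivity : (0 : ℝ) ≤ n) (sub_nonneg.2 hn')]
  have h8 : (0 : ℝ) ≤ (n : ℝ) ^ 3 := by positivity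
  rw [div_pow] at h6
  linarith

/-! ### The asymptotic statements -/

theorem isBigO_maxPlanarCopies_path_seven :
    (fun n : ℕ => (maxPlanarCopies n (SimpleGraph.pathGraph 7) : ℝ) - 4 / 27 * (n : ℝ) ^ 4)
      =O[atTop] fun n : ℕ => (n : ℝ) ^ ((4 : ℝ) - 1 / 5) := by
  refine IsBigO.of_bound (32 ^ 3 * (65537 * 3 + 65536)) ?_
  filter_upwards [eventually_ge_atTop 15] with n hn
  have hn1 : (1 : ℝ) ≤ n := by exact_mod_cast (by omega : 1 ≤ n)
  have hu := maxPlanarCopies_path_seven_le (n := n) (by omega)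
  have hl := le_maxPlanarCopies_path_seven_real hn
  have h3 : (n : ℝ) ^ 3 ≤ (n : ℝ) ^ ((4 : ℝ) - 1 / 5) := by
    rw [← Real.rpow_natCast]
    exact Real.rpow_le_rpow_of_exponent_le hn1 (by norm_num)
  have h0 : 0 ≤ (n : ℝ) ^ 3 := by positivity
  rw [Real.norm_eq_abs, Real.norm_of_nonneg (by positivity), abs_le]
  constructor <;> linarith

theorem isBigO_maxPlanarCopies_path_odd {m : ℕ} (hm : 3 ≤ m) :
    (fun n : ℕ => max 0 ((maxPlanarCopies n (SimpleGraph.pathGraph (2 * m + 1)) : ℝ) -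
      (n : ℝ) ^ (m + 1) / (2 * ((m - 1).factorial : ℝ))))
      =O[atTop] fun n : ℕ => (n : ℝ) ^ ((m : ℝ) + 4 / 5) := by
  refine IsBigO.of_bound (32 ^ m * (65537 * m + 65536)) ?_
  filter_upwards [eventually_gt_atTop 0] with n hn
  have hu := maxPlanarCopies_path_odd_le hn hm
  rw [Real.norm_of_nonneg (le_max_left _ _), Real.norm_of_nonneg (by positivity)]
  exact max_le (by positivity) (by linarith)

theorem theorem1 :
    ((fun n : ℕ => (maxPlanarCopies n (SimpleGraph.pathGraph 7) : ℝ) - 4 / 27 * (n : ℝ) ^ 4)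
      =O[atTop] fun n : ℕ => (n : ℝ) ^ ((4 : ℝ) - 1 / 5)) ∧
    ∀ m : ℕ, 4 ≤ m → ∃ err : ℕ → ℝ,
      (err =O[atTop] fun n : ℕ => (n : ℝ) ^ ((m : ℝ) + 4 / 5)) ∧
      ∀ n : ℕ, (maxPlanarCopies n (SimpleGraph.pathGraph (2 * m + 1)) : ℝ) ≤
        (n : ℝ) ^ (m + 1) / (2 * ((m - 1).factorial : ℝ)) + err n := by
  refine ⟨isBigO_maxPlanarCopies_path_seven, fun m hm =>
    ⟨_, isBigO_maxPlanarCopies_path_odd (by omega : 3 ≤ m), fun n => ?_⟩⟩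
  have := le_max_right 0 ((maxPlanarCopies n (SimpleGraph.pathGraph (2 * m + 1)) : ℝ) -
      (n : ℝ) ^ (m + 1) / (2 * ((m - 1).factorial : ℝ)))
  linarith
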